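/- Let $\mathbb K\in\{\mathbb R,\mathbb C\}$, let $\Omega$ be a locally compact Hausdorff space, and let $C_0(\Omega)$ be the Banach algebra of continuous functions $\Omega\to\mathbb K$ vanishing at infinity, with the supremum norm. A *Banach module* over $C_0(\Omega)$ is a Banach space $\Gamma$ over $\mathbb K$ with a $\mathbb K$-bilinear module multiplication $C_0(\Omega)\times\Gamma\to\Gamma$ such that $\|fs\|\le\|f\|\,\|s\|$ for all $f\in C_0(\Omega)$, $s\in\Gamma$, and such that the linear span of $\{fs : f\in C_0(\Omega),\, s\in\Gamma\}$ is dense in $\Gamma$. For $s\in\Gamma$ the closed submodule $\Gamma_s=\overline{C_0(\Omega)\cdot s}$ is a Banach lattice with positive cone $\overline{C_0(\Omega)_+\cdot s}$, where $C_0(\Omega)_+=\{f\in C_0(\Omega): f\ge 0\}$. $\Gamma$ is an *AM-module* if each $\Gamma_s$ is an AM-space, i.e. $\|u\vee v\|=\max(\|u\|,\|v\|)$ for all positive $u,v\in\Gamma_s$. A *(topological) Banach bundle* over $\Omega$ is a topological space $E$ with a continuous, open, surjective map $p\colon E\to\Omega$ such that every fiber $E_x=p^{-1}(x)$ is a Banach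 space over $\mathbb K$, fiberwise addition $E\times_\Omega E\to E$ and scalar multiplication $\mathbb K\times E\to E$ are continuous, the norm $E\to[0,\infty)$ is upper semicontinuous, and for each $x\in\Omega$ and each open $W\subset E$ containing the zero of $E_x$ there are $\varepsilon>0$ and an open neighborhood $U$ of $x$ with $\{v\in p^{-1}(U):\|v\|\le\varepsilon\}\subset W$. $\Gamma_0(E)$ denotes the space of continuous sections $s\colon\Omega\to E$ such that for every $\varepsilon>0$ there is a compact $K\subset\Omega$ with $\|s(x)\|\le\varepsilon$ for all $x\notin K$, with the norm $\|s\|=\sup_{x\in\Omega}\|s(x)\|$ and the pointwise multiplication by functions in $C_0(\Omega)$. An *isometric isomorphism* of Banach bundles $E$, $F$ over $\Omega$ is a homeomorphism $E\to F$ that restricts, for each $x\in\Omega$, to a linear isometric bijection $E_x\to F_x$. An isometric isomorphism of modules over $C_0(\Omega)$ is a linear isometric bijection that commutes with the multiplication by every $f\in C_0(\Omega)$. **Proposition.** Let $\Gamma$ be an AM-module over $C_0(\Omega)$. Then there is a Banach bundle $E$ over $\Omega$ such that $\Gamma_0(E)$ is isometrically isomorphic to $\Gamma$ as a module over $C_0(\Omega)$.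 Moreover, $E$ is unique up to isometric isomorphism: if $E$ and $F$ are Banach bundles over $\Omega$ such that $\Gamma_0(E)$ and $\Gamma_0(F)$ are both isometrically isomorphic to $\Gamma$ as modules over $C_0(\Omega)$, then $E$ and $F$ are isometrically isomorphic. -/

import Mathlib

open Topology
open scoped ZeroAtInfty

universe u v w₁ w₂

noncomputable section

namespace RepBundle

/-! ### Banach modules over a commutative Banach algebra -/

/-- `Γ` (a normed space, assumed complete where the class is used) with the scalar multiplication
`A × Γ → Γ` is a (non-degenerate) Banach module over the commutative Banach algebra `A`.  The
algebra need not be unital. -/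
class IsBanachModule (𝕜 : Type*) (A : Type*) (Γ : Type*) [RCLike 𝕜]
    [NonUnitalNormedCommRing A] [NormedSpace 𝕜 A]
    [NormedAddCommGroup Γ] [NormedSpace 𝕜 Γ] [SMul A Γ] : Prop where
  smul_add : ∀ (f : A) (s t : Γ), f • (s + t) = f • s + f • t
  add_smul : ∀ (f g : A) (s : Γ), (f + g) • s = f • s + g • s
  mul_smul : ∀ (f g : A) (s : Γ), (f * g) • s = f • (g • s)
  scalar_smul : ∀ (c : 𝕜) (f : A) (s : Γ), (c • f) • s = c • (f • s)
  smul_scalar : ∀ (c : 𝕜) (f : A) (s : Γ), f • (c • s) = c • (f • s)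
  norm_smul_le : ∀ (f : A) (s : Γ), ‖f • s‖ ≤ ‖f‖ * ‖s‖
  nondegenerate :
    closure (Submodule.span 𝕜 {t : Γ | ∃ (f : A) (s : Γ), t = f • s} : Set Γ) = Set.univ

/-- `Γ` and `Λ` are isometrically isomorphic as modules over `A`. -/
def IsometricallyIsomorphicModules (𝕜 : Type*) (A : Type*) (Γ : Type*) (Λ : Type*) [RCLike 𝕜]
    [NormedAddCommGroup Γ] [NormedSpace 𝕜 Γ] [SMul A Γ]
    [NormedAddCommGroup Λ] [NormedSpace 𝕜 Λ] [SMul A Λ] : Prop :=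
  ∃ T : Γ ≃ₗᵢ[𝕜] Λ, ∀ (f : A) (s : Γ), T (f • s) = f • T s

/-! ### AM-modules -/

section AM

variable (𝕜 : Type*) (Ω : Type u) {Γ : Type v} [RCLike 𝕜] [TopologicalSpace Ω]
  [NormedAddCommGroup Γ] [NormedSpace 𝕜 Γ] [SMul C₀(Ω, 𝕜) Γ]

/-- The closed submodule `Γ_s`, the closure of `C₀(Ω) · s`. -/
def cyclicSubmodule (s : Γ) : Set Γ :=
  closure {t : Γ | ∃ f : C₀(Ω, 𝕜), t = f • s}

/-- The positive cone of `Γ_s`: the closure of `C₀(Ω)₊ · s`. -/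
def positiveCone (s : Γ) : Set Γ :=
  closure {t : Γ | ∃ f : C₀(Ω, 𝕜),
    (∀ x, 0 ≤ RCLike.re (f x) ∧ RCLike.im (f x) = 0) ∧ t = f • s}

/-- The order of `Γ_s` defined by its positive cone. -/
def coneLE (s t₁ t₂ : Γ) : Prop := t₂ - t₁ ∈ positiveCone 𝕜 Ω s

/-- `w` is the supremum `u ∨ v` in the ordered space `Γ_s`. -/
def IsSupremum (s u v w : Γ) : Prop :=
  w ∈ cyclicSubmodule 𝕜 Ω s ∧ coneLE 𝕜 Ω s u w ∧ coneLE 𝕜 Ω s v w ∧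
    ∀ z ∈ cyclicSubmodule 𝕜 Ω s, coneLE 𝕜 Ω s u z → coneLE 𝕜 Ω s v z → coneLE 𝕜 Ω s w z

variable (Γ) in
/-- A Banach module `Γ` over `C₀(Ω)` is an AM-module if each `Γ_s` is an AM-space, i.e.
`‖u ∨ v‖ = max ‖u‖ ‖v‖` for all positive `u, v` in `Γ_s`.  (For a Banach module the space `Γ_s`
with the cone above always is a Banach lattice, so that `u ∨ v` exists and is unique.) -/
def IsAMModule : Prop :=
  ∀ s : Γ, ∀ u ∈ positiveCone 𝕜 Ω s, ∀ v ∈ positiveCone 𝕜 Ω s, ∀ w : Γ,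
    IsSupremum 𝕜 Ω s u v w → ‖w‖ = max ‖u‖ ‖v‖

end AM

/-! ### Topological Banach bundles -/

/-- A (topological) Banach bundle over `Ω`: a family of Banach spaces (the fibers) together with
a topology on the disjoint union of the fibers.  `Bundle.TotalSpace PUnit Fiber` is the disjoint
union of the fibers; its first argument is a dummy.  The projection is surjective since fibers
contain zero. -/
structure BanachBundle (𝕜 : Type*) [RCLike 𝕜] (Ω : Type u) [TopologicalSpace Ω] where
  Fiber : Ω → Type v
  [instNormedAddCommGroup : ∀ x, NormedAddCommGroup (Fiber x)]
  [instNormedSpace : ∀ x, NormedSpace 𝕜 (Fiber x)]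
  [instCompleteSpace : ∀ x, CompleteSpace (Fiber x)]
  [instTopology : TopologicalSpace (Bundle.TotalSpace PUnit.{1} Fiber)]
  continuous_proj : Continuous (fun p : Bundle.TotalSpace PUnit.{1} Fiber => p.proj)
  isOpenMap_proj : IsOpenMap (fun p : Bundle.TotalSpace PUnit.{1} Fiber => p.proj)
  /-- Addition is continuous on the fiber product, which carries the subspace topology of the
  product of the total space with itself. -/
  continuous_add :
    @Continuous (Σ x, Fiber x × Fiber x) (Bundle.TotalSpace PUnit.{1} Fiber)
      (TopologicalSpace.induced
        (fun q => ((⟨q.1, q.2.1⟩, ⟨q.1, q.2.2⟩) :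
          Bundle.TotalSpace PUnit.{1} Fiber × Bundle.TotalSpace PUnit.{1} Fiber))
        inferInstance)
      instTopology (fun q => ⟨q.1, q.2.1 + q.2.2⟩)
  continuous_smul :
    Continuous (fun q : 𝕜 × Bundle.TotalSpace PUnit.{1} Fiber =>
      (⟨q.2.proj, q.1 • q.2.snd⟩ : Bundle.TotalSpace PUnit.{1} Fiber))
  upperSemicontinuous_norm :
    UpperSemicontinuous (fun p : Bundle.TotalSpace PUnit.{1} Fiber => ‖p.snd‖)
  zero_nhds : ∀ (x : Ω) (W : Set (Bundle.TotalSpace PUnit.{1} Fiber)), IsOpen W → ⟨x, 0⟩ ∈ W →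
    ∃ ε : ℝ, 0 < ε ∧ ∃ U : Set Ω, IsOpen U ∧ x ∈ U ∧
      ∀ p : Bundle.TotalSpace PUnit.{1} Fiber, p.proj ∈ U → ‖p.snd‖ ≤ ε → p ∈ W

namespace BanachBundle

attribute [instance] instNormedAddCommGroup instNormedSpace instCompleteSpace instTopology

variable {𝕜 : Type*} [RCLike 𝕜] {Ω : Type u} [TopologicalSpace Ω]

/-- The total space of the bundle. -/
abbrev Total (E : BanachBundle.{u, v} 𝕜 Ω) : Type (max u v) := Bundle.TotalSpace PUnit.{1} E.Fiber

/-- The set-theoretic section `s`, as a map into the total space. -/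
def toTotal (E : BanachBundle.{u, v} 𝕜 Ω) (s : ∀ x, E.Fiber x) (x : Ω) : E.Total := ⟨x, s x⟩

/-- The section `s` vanishes at infinity. -/
def VanishesAtInfty (E : BanachBundle.{u, v} 𝕜 Ω) (s : ∀ x, E.Fiber x) : Prop :=
  ∀ ε : ℝ, 0 < ε → ∃ K : Set Ω, IsCompact K ∧ ∀ x, x ∉ K → ‖s x‖ ≤ ε

variable (E : BanachBundle.{u, v} 𝕜 Ω)

theorem continuous_toTotal_zero : Continuous (E.toTotal 0) := by
  rw [continuous_iff_continuousAt]
  intro x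
  rw [ContinuousAt, tendsto_nhds]
  intro W hW hx
  obtain ⟨ε, hε, U, hU, hxU, h⟩ := E.zero_nhds x W hW hx
  filter_upwards [hU.mem_nhds hxU] with y hy
  exact h _ hy (by
    change ‖(0 : E.Fiber y)‖ ≤ ε
    rw [norm_zero]
    exact hε.le)

theorem continuous_toTotal_add {s t : ∀ x, E.Fiber x} (hs : Continuous (E.toTotal s))
    (ht : Continuous (E.toTotal t)) : Continuous (E.toTotal (s + t)) := by
  let _ : TopologicalSpace (Σ x, E.Fiber x × E.Fiber x) := TopologicalSpace.induced
    (fun q => ((⟨q.1, q.2.1⟩, ⟨q.1, q.2.2⟩) : E.Total × E.Total)) inferInstance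
  have h : Continuous (fun x : Ω => (⟨x, s x, t x⟩ : Σ x, E.Fiber x × E.Fiber x)) :=
    continuous_induced_rng.2 (hs.prodMk ht)
  exact E.continuous_add.comp h

theorem continuous_toTotal_smul {f : Ω → 𝕜} (hf : Continuous f) {s : ∀ x, E.Fiber x}
    (hs : Continuous (E.toTotal s)) : Continuous (E.toTotal (fun x => f x • s x)) :=
  E.continuous_smul.comp (hf.prodMk hs)

theorem VanishesAtInfty.smul_of_bounded {E : BanachBundle.{u, v} 𝕜 Ω} {s : ∀ x, E.Fiber x}
    (hs : E.VanishesAtInfty s) {f : Ω → 𝕜} {C : ℝ} (hf : ∀ x, ‖f x‖ ≤ C) :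
    E.VanishesAtInfty (fun x => f x • s x) := by
  intro ε hε
  have hC : 0 < |C| + 1 := by positivity
  obtain ⟨K, hK, h⟩ := hs (ε / (|C| + 1)) (by positivity)
  refine ⟨K, hK, fun x hx => ?_⟩
  rw [norm_smul]
  calc ‖f x‖ * ‖s x‖ ≤ (|C| + 1) * (ε / (|C| + 1)) := by
        gcongr
        · exact (hf x).trans ((le_abs_self C).trans (by linarith))
        · exact h x hx
    _ = ε := by field_simp

/-- The space `Γ₀(E)` of continuous sections vanishing at infinity, as a space of functions. -/
def sectionSubmodule : Submodule 𝕜 (∀ x, E.Fiber x) where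
  carrier := {s | Continuous (E.toTotal s) ∧ E.VanishesAtInfty s}
  zero_mem' := ⟨E.continuous_toTotal_zero, fun ε hε => ⟨∅, isCompact_empty, by simp [hε.le]⟩⟩
  add_mem' := by
    rintro s t ⟨hs, hs'⟩ ⟨ht, ht'⟩
    refine ⟨E.continuous_toTotal_add hs ht, fun ε hε => ?_⟩
    obtain ⟨K, hK, h⟩ := hs' (ε / 2) (by positivity)
    obtain ⟨L, hL, h'⟩ := ht' (ε / 2) (by positivity)
    refine ⟨K ∪ L, hK.union hL, fun x hx => ?_⟩
    simp only [Set.mem_union, not_or] at hx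
    have h1 := h x hx.1
    have h2 := h' x hx.2
    have h3 : ‖(s + t) x‖ ≤ ‖s x‖ + ‖t x‖ := norm_add_le _ _
    linarith
  smul_mem' := by
    rintro c s ⟨hs, hs'⟩
    exact ⟨E.continuous_toTotal_smul (continuous_const (y := c)) hs,
      hs'.smul_of_bounded (f := fun _ => c) (C := ‖c‖) (fun _ => le_rfl)⟩

/-- The space `Γ₀(E)` of continuous sections vanishing at infinity; it carries the supremum norm
and the pointwise multiplication by functions in `C₀(Ω)`. -/
def SectionsZero : Type (max u v) := E.sectionSubmodule

namespace SectionsZero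

instance : AddCommGroup E.SectionsZero := inferInstanceAs (AddCommGroup E.sectionSubmodule)

instance : Module 𝕜 E.SectionsZero := inferInstanceAs (Module 𝕜 E.sectionSubmodule)

instance : CoeFun E.SectionsZero (fun _ => ∀ x, E.Fiber x) := ⟨fun s => s.1⟩

instance : Norm E.SectionsZero := ⟨fun s => ⨆ x, ‖s x‖⟩

theorem bddAbove (s : E.SectionsZero) : BddAbove (Set.range fun x => ‖s x‖) := by
  obtain ⟨K, hK, h⟩ := s.2.2 1 one_pos
  have husc : UpperSemicontinuous (fun x => ‖s x‖) := fun x =>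
    (E.upperSemicontinuous_norm (E.toTotal s.1 x)).comp (s.2.1.continuousAt)
  obtain ⟨M, hM⟩ := (husc.upperSemicontinuousOn K).bddAbove_of_isCompact hK
  refine ⟨max M 1, ?_⟩
  rintro _ ⟨x, rfl⟩
  by_cases hx : x ∈ K
  · exact le_max_of_le_left (hM ⟨x, hx, rfl⟩)
  · exact le_max_of_le_right (h x hx)

theorem core : NormedSpace.Core 𝕜 E.SectionsZero where
  norm_nonneg s := Real.iSup_nonneg fun x => norm_nonneg _
  norm_smul c s := by
    change ⨆ x, ‖c • s x‖ = ‖c‖ * ⨆ x, ‖s x‖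
    simp_rw [norm_smul]
    rw [Real.mul_iSup_of_nonneg (norm_nonneg c)]
  norm_triangle s t := by
    refine Real.iSup_le (fun x => ?_)
      (add_nonneg (Real.iSup_nonneg fun x => norm_nonneg _)
        (Real.iSup_nonneg fun x => norm_nonneg _))
    exact (norm_add_le (s x) (t x)).trans
      (add_le_add (le_ciSup (bddAbove E s) x) (le_ciSup (bddAbove E t) x))
  norm_eq_zero_iff s := by
    constructor
    · intro h
      apply Subtype.ext
      funext x
      have h1 : ‖s x‖ ≤ 0 := (le_ciSup (bddAbove E s) x).trans (le_of_eq h)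
      exact norm_le_zero_iff.1 h1
    · rintro rfl
      change ⨆ x, ‖(0 : E.Fiber x)‖ = 0
      simp

instance : NormedAddCommGroup E.SectionsZero := NormedAddCommGroup.ofCore (core E)

instance : NormedSpace 𝕜 E.SectionsZero := NormedSpace.ofCore (core E)

instance : SMul C₀(Ω, 𝕜) E.SectionsZero :=
  ⟨fun f s => ⟨fun x => f x • s x, E.continuous_toTotal_smul f.continuous s.2.1,
    s.2.2.smul_of_bounded (C := ‖f‖) (fun x => f.toBCF.norm_coe_le_norm x)⟩⟩

end SectionsZero

variable {E}

/-- An isometric isomorphism of Banach bundles over `Ω` (over the identity of `Ω`): a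
homeomorphism of the total spaces which maps each fiber linearly and isometrically onto the fiber
over the same point. -/
structure IsometricIso (E : BanachBundle.{u, w₁} 𝕜 Ω) (F : BanachBundle.{u, w₂} 𝕜 Ω) where
  fiberEquiv : ∀ x, E.Fiber x ≃ₗᵢ[𝕜] F.Fiber x
  continuous_toFun :
    Continuous (fun p : E.Total => (⟨p.proj, fiberEquiv p.proj p.snd⟩ : F.Total))
  continuous_invFun :
    Continuous (fun p : F.Total => (⟨p.proj, (fiberEquiv p.proj).symm p.snd⟩ : E.Total))

end BanachBundle

end RepBundle

end

/-! Existence rests on localization. Call `φ` a bump at `x` if `0 ≤ φ ≤ 1` and `φ = 1` near `x`. The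
fiber at `x` is `Γ` modulo the elements that bumps at `x` make arbitrarily small in norm, and the
norm of a class is the infimum of `‖φ s‖` over these bumps. A bump at `x` is also a bump at all
nearby points, so estimates at one point spread to a neighborhood; this makes the quotient topology
from `Ω × Γ` a bundle topology. The AM hypothesis is what makes `s ↦ (x ↦ s(x))` isometric. In `Γ_s`
the supremum of `f s` and `g s` is `(f ∨ g) s` (`isSupremum_smul`), so finitely many bumps with
`‖φ_i s‖ < M` have a maximum `Φ` with `‖Φ s‖ ≤ M`; if they cover a large compact set, `Φ s` is close
to `s` (`IsAMModule.norm_le_of_forall_norm_localValue_lt`). Partitions of unity give dense range,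
hence surjectivity. For uniqueness, `‖s(x)‖` can be recovered from the module as the infimum of `‖φ
s‖`, so a module isomorphism acts fiberwise and isometrically. To define it on all of each fiber,
and to prove continuity, every vector must lie on a continuous section
(`exists_sectionsZero_apply_eq`). Such sections are uniform limits of sections that are continuous
only up to an error. -/

noncomputable section

namespace RepBundle

/-! ### Functions vanishing at infinity and partitions of unity -/

section Functions

variable {Ω : Type u} [TopologicalSpace Ω]

/-- A real function vanishing at infinity, regarded as a `𝕜`-valued one. -/
def ofRealC₀ (𝕜 : Type*) [RCLike 𝕜] (f : C₀(Ω, ℝ)) : C₀(Ω, 𝕜) where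
  toFun x := (f x : 𝕜)
  continuous_toFun := RCLike.continuous_ofReal.comp f.continuous
  zero_at_infty' := by
    have h := (RCLike.continuous_ofReal (K := 𝕜)).tendsto 0
    rw [RCLike.ofReal_zero] at h
    exact h.comp f.zero_at_infty'

@[simp]
theorem ofRealC₀_apply (𝕜 : Type*) [RCLike 𝕜] (f : C₀(Ω, ℝ)) (x : Ω) :
    ofRealC₀ 𝕜 f x = (f x : 𝕜) := rfl

/-- Composition of a function vanishing at infinity with a continuous function fixing zero. -/
def postcompC₀ {α β : Type*} [TopologicalSpace α] [TopologicalSpace β] [Zero α] [Zero β]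
    (θ : C(α, β)) (hθ : θ 0 = 0) (f : C₀(Ω, α)) : C₀(Ω, β) where
  toFun x := θ (f x)
  continuous_toFun := θ.continuous.comp f.continuous
  zero_at_infty' := by
    have h := θ.continuous.tendsto 0
    rw [hθ] at h
    exact h.comp f.zero_at_infty'

@[simp]
theorem postcompC₀_apply {α β : Type*} [TopologicalSpace α] [TopologicalSpace β] [Zero α] [Zero β]
    (θ : C(α, β)) (hθ : θ 0 = 0) (f : C₀(Ω, α)) (x : Ω) : postcompC₀ θ hθ f x = θ (f x) := rfl

/-- The positive part of a real function vanishing at infinity. -/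
def posPartC₀ (f : C₀(Ω, ℝ)) : C₀(Ω, ℝ) :=
  postcompC₀ ⟨fun t => max t 0, by fun_prop⟩ (by simp) f

@[simp]
theorem posPartC₀_apply (f : C₀(Ω, ℝ)) (x : Ω) : posPartC₀ f x = max (f x) 0 := rfl

/-- The pointwise maximum of two real functions vanishing at infinity. -/
def supC₀ (f g : C₀(Ω, ℝ)) : C₀(Ω, ℝ) := f + posPartC₀ (g - f)

@[simp]
theorem supC₀_apply (f g : C₀(Ω, ℝ)) (x : Ω) : supC₀ f g x = max (f x) (g x) := by
  simp only [supC₀, ZeroAtInftyContinuousMap.add_apply, posPartC₀_apply,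
    ZeroAtInftyContinuousMap.sub_apply]
  rw [← max_add_add_left, add_sub_cancel, add_zero, max_comm]

/-- A continuous function with compact support, as a function vanishing at infinity. -/
def compactC₀ (f : C(Ω, ℝ)) (hf : HasCompactSupport f) : C₀(Ω, ℝ) := ⟨f, hf.is_zero_at_infty⟩

@[simp]
theorem compactC₀_apply (f : C(Ω, ℝ)) (hf : HasCompactSupport f) (x : Ω) :
    compactC₀ f hf x = f x := rfl

theorem norm_le_of_forall_norm_le {β : Type*} [NormedAddCommGroup β] (f : C₀(Ω, β)) {C : ℝ}
    (hC : 0 ≤ C) (h : ∀ x, ‖f x‖ ≤ C) : ‖f‖ ≤ C := by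
  rw [← ZeroAtInftyContinuousMap.norm_toBCF_eq_norm]
  exact (BoundedContinuousFunction.norm_le hC).2 h

/-- `φ` takes values in `[0, 1]` and is equal to one near `x`. -/
structure IsBump (x : Ω) (φ : C₀(Ω, ℝ)) : Prop where
  mem_Icc : ∀ y, φ y ∈ Set.Icc (0 : ℝ) 1
  eventually_eq_one : ∀ᶠ y in 𝓝 x, φ y = 1

namespace IsBump

variable {x : Ω} {φ ψ : C₀(Ω, ℝ)}

/-- This is why a bump must be one on a neighborhood and not just at the point. -/
theorem eventually (h : IsBump x φ) : ∀ᶠ y in 𝓝 x, IsBump y φ := by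
  filter_upwards [eventually_eventually_nhds.2 h.eventually_eq_one] with y hy
  exact ⟨h.mem_Icc, hy⟩

theorem mul (hφ : IsBump x φ) (hψ : IsBump x ψ) : IsBump x (φ * ψ) where
  mem_Icc y := ⟨mul_nonneg (hφ.mem_Icc y).1 (hψ.mem_Icc y).1,
    mul_le_one₀ (hφ.mem_Icc y).2 (hψ.mem_Icc y).1 (hψ.mem_Icc y).2⟩
  eventually_eq_one := by
    filter_upwards [hφ.eventually_eq_one, hψ.eventually_eq_one] with y h1 h2
    simp [h1, h2]

end IsBump

variable [T2Space Ω] [LocallyCompactSpace Ω]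

/-- Finite partitions of unity subordinate to an open cover of a compact set. -/
theorem exists_finset_partition {ι : Type*} {K : Set Ω} (hK : IsCompact K) (U : ι → Set Ω)
    (hU : ∀ i, IsOpen (U i)) (hKU : K ⊆ ⋃ i, U i) :
    ∃ (I : Finset ι) (φ : ι → C(Ω, ℝ)), (∀ i, tsupport (φ i) ⊆ U i) ∧
      (∀ i, HasCompactSupport (φ i)) ∧ (∀ i x, 0 ≤ φ i x) ∧ (∀ x, ∑ i ∈ I, φ i x ≤ 1) ∧
      ∀ x ∈ K, ∑ i ∈ I, φ i x = 1 := by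
  classical
  obtain ⟨I, hI⟩ := hK.elim_finite_subcover U hU hKU
  -- Emptying the sets outside the finite subcover makes the family locally finite and reduces the
  -- sums to `I`.
  let V : ι → Set Ω := fun i => if i ∈ I then U i else ∅
  have hV : ∀ i, IsOpen (V i) := fun i => by
    by_cases hi : i ∈ I <;> simp [V, hi, hU]
  have hVf : LocallyFinite V := fun x => ⟨Set.univ, Filter.univ_mem, by
    refine I.finite_toSet.subset fun i hi => ?_
    by_contra h
    have h' : i ∉ I := by simpa using h
    simp [V, h'] at hi⟩
  have hKV : K ⊆ ⋃ i, V i := fun x hx => by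
    obtain ⟨i, hi, hxi⟩ := Set.mem_iUnion₂.1 (hI hx)
    exact Set.mem_iUnion.2 ⟨i, by simp [V, hi, hxi]⟩
  obtain ⟨φ, hφ, hc⟩ :=
    PartitionOfUnity.exists_isSubordinate_of_locallyFinite_t2space hK V hV hVf hKV
  have hsum : ∀ x, ∑ᶠ i, φ i x = ∑ i ∈ I, φ i x := fun x => by
    refine finsum_eq_sum_of_support_subset _ fun i hi => ?_
    by_contra h
    have h' : i ∉ I := by simpa using h
    have := hφ i (subset_tsupport _ hi)
    simp [V, h'] at this
  refine ⟨I, fun i => φ i, fun i x hx => ?_, hc, φ.nonneg, fun x => ?_, fun x hx => ?_⟩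
  · have := hφ i hx
    by_cases hi : i ∈ I
    · simpa [V, hi] using this
    · simp [V, hi] at this
  · rw [← hsum]; exact φ.sum_le_one x
  · rw [← hsum]; exact φ.sum_eq_one hx

theorem exists_compact_bump {K U : Set Ω} (hK : IsCompact K) (hU : IsOpen U) (hKU : K ⊆ U) :
    ∃ φ : C₀(Ω, ℝ), (∀ y, φ y ∈ Set.Icc (0 : ℝ) 1) ∧ (∀ y ∈ K, φ y = 1) ∧
      HasCompactSupport φ ∧ tsupport φ ⊆ U := by
  obtain ⟨I, φ, h1, h2, h3, h4, h5⟩ := exists_finset_partition hK (fun _ : Unit => U)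
    (fun _ => hU) (by simpa [Set.iUnion_const] using hKU)
  by_cases hI : () ∈ I
  · have : I = {()} := by ext i; simpa using hI
    subst this
    simp only [Finset.sum_singleton] at h4 h5
    exact ⟨compactC₀ (φ ()) (h2 ()), fun y => ⟨h3 () y, h4 y⟩, h5, h2 (), h1 ()⟩
  -- An empty sum is never one, so `K` is empty here and `φ = 0` works.
  · have : I = ∅ := by ext i; simpa using hI
    subst this
    simp only [Finset.sum_empty, zero_ne_one, imp_false] at h5
    have h0 : tsupport ((0 : C₀(Ω, ℝ)) : Ω → ℝ) = ∅ := by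
      rw [tsupport_eq_empty_iff]; rfl
    refine ⟨0, fun y => by simp, fun y hy => (h5 y hy).elim, ?_, by simp⟩
    rw [HasCompactSupport, h0]
    exact isCompact_empty

theorem exists_isBump {x : Ω} {U : Set Ω} (hU : U ∈ 𝓝 x) :
    ∃ φ : C₀(Ω, ℝ), IsBump x φ ∧ HasCompactSupport φ ∧ tsupport φ ⊆ U := by
  obtain ⟨V, hVU, hV, hxV⟩ := mem_nhds_iff.1 hU
  obtain ⟨K, hK, hxK, hKV⟩ := exists_compact_subset hV hxV
  obtain ⟨φ, h1, h2, h3, h4⟩ := exists_compact_bump hK hV hKV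
  refine ⟨φ, ⟨h1, ?_⟩, h3, h4.trans hVU⟩
  filter_upwards [mem_interior_iff_mem_nhds.1 hxK] with y hy using h2 y hy

end Functions

/-! ### Banach modules over `C₀(Ω)` -/

section Cone

variable {𝕜 : Type*} [RCLike 𝕜] {Ω : Type u} [TopologicalSpace Ω]
  {Γ : Type v} [NormedAddCommGroup Γ] [SMul C₀(Ω, 𝕜) Γ]

theorem ofRealC₀_smul_mem_positiveCone (f : C₀(Ω, ℝ)) (hf : ∀ x, 0 ≤ f x) (s : Γ) :
    ofRealC₀ 𝕜 f • s ∈ positiveCone 𝕜 Ω s :=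
  subset_closure ⟨_, fun x => by simp [hf x], rfl⟩

theorem exists_of_mem_positiveCone {s t : Γ} (ht : t ∈ positiveCone 𝕜 Ω s) {ε : ℝ} (hε : 0 < ε) :
    ∃ h : C₀(Ω, ℝ), (∀ x, 0 ≤ h x) ∧ ‖t - ofRealC₀ 𝕜 h • s‖ < ε := by
  obtain ⟨_, ⟨f, hf, rfl⟩, h⟩ := Metric.mem_closure_iff.1 ht ε hε
  let g : C₀(Ω, ℝ) := postcompC₀ ⟨RCLike.re, RCLike.continuous_re⟩ (by simp) f
  refine ⟨g, fun x => (hf x).1, ?_⟩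
  have : ofRealC₀ 𝕜 g = f := by
    ext x
    apply RCLike.ext <;> simp [g, (hf x).2]
  rwa [this, ← dist_eq_norm]

end Cone

section Module

variable {𝕜 : Type*} [RCLike 𝕜] {Ω : Type u} [TopologicalSpace Ω]
  {Γ : Type v} [NormedAddCommGroup Γ] [NormedSpace 𝕜 Γ] [SMul C₀(Ω, 𝕜) Γ]
  [IsBanachModule 𝕜 C₀(Ω, 𝕜) Γ]

variable (𝕜 Ω Γ) in
/-- The multiplication of a Banach module, as a bilinear map. -/
def smulBilin : C₀(Ω, 𝕜) →ₗ[𝕜] Γ →ₗ[𝕜] Γ :=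
  LinearMap.mk₂ 𝕜 (fun f s => f • s) (IsBanachModule.add_smul (𝕜 := 𝕜))
    (IsBanachModule.scalar_smul (𝕜 := 𝕜)) (IsBanachModule.smul_add (𝕜 := 𝕜))
    (fun c f s => IsBanachModule.smul_scalar (𝕜 := 𝕜) c f s)

theorem smul_sub' (f : C₀(Ω, 𝕜)) (s t : Γ) : f • (s - t) = f • s - f • t :=
  (smulBilin 𝕜 Ω Γ f).map_sub s t

theorem smul_add' (f : C₀(Ω, 𝕜)) (s t : Γ) : f • (s + t) = f • s + f • t :=
  (smulBilin 𝕜 Ω Γ f).map_add s t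

theorem smul_zero' (f : C₀(Ω, 𝕜)) : f • (0 : Γ) = 0 := (smulBilin 𝕜 Ω Γ f).map_zero

theorem add_smul' (f g : C₀(Ω, 𝕜)) (s : Γ) : (f + g) • s = f • s + g • s :=
  (smulBilin 𝕜 Ω Γ).map_add₂ f g s

theorem sub_smul' (f g : C₀(Ω, 𝕜)) (s : Γ) : (f - g) • s = f • s - g • s :=
  (smulBilin 𝕜 Ω Γ).map_sub₂ f g s

theorem zero_smul' (s : Γ) : (0 : C₀(Ω, 𝕜)) • s = 0 := (smulBilin 𝕜 Ω Γ).map_zero₂ s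

theorem mul_smul' (f g : C₀(Ω, 𝕜)) (s : Γ) : (f * g) • s = f • (g • s) :=
  IsBanachModule.mul_smul (𝕜 := 𝕜) f g s

theorem scalar_smul' (c : 𝕜) (f : C₀(Ω, 𝕜)) (s : Γ) : (c • f) • s = c • (f • s) :=
  IsBanachModule.scalar_smul c f s

theorem smul_scalar' (c : 𝕜) (f : C₀(Ω, 𝕜)) (s : Γ) : f • (c • s) = c • (f • s) :=
  IsBanachModule.smul_scalar c f s

theorem norm_smul_le_of_forall_norm_le (f : C₀(Ω, 𝕜)) (s : Γ) {C : ℝ} (hC : 0 ≤ C)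
    (h : ∀ x, ‖f x‖ ≤ C) : ‖f • s‖ ≤ C * ‖s‖ :=
  (IsBanachModule.norm_smul_le (𝕜 := 𝕜) f s).trans
    (mul_le_mul_of_nonneg_right (norm_le_of_forall_norm_le f hC h) (norm_nonneg s))

theorem norm_ofRealC₀_smul_le (f : C₀(Ω, ℝ)) (s : Γ) (h : ∀ x, f x ∈ Set.Icc (0 : ℝ) 1) :
    ‖ofRealC₀ 𝕜 f • s‖ ≤ ‖s‖ := by
  have := norm_smul_le_of_forall_norm_le (ofRealC₀ 𝕜 f) s zero_le_one fun x => by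
    rw [ofRealC₀_apply, RCLike.norm_ofReal, abs_of_nonneg (h x).1]
    exact (h x).2
  simpa using this

/-! ### Approximate units -/

theorem exists_compact_approx_function [T2Space Ω] [LocallyCompactSpace Ω]
    (f : C₀(Ω, 𝕜)) {ε : ℝ} (hε : 0 < ε) :
    ∃ K : Set Ω, IsCompact K ∧ ∀ e : C₀(Ω, ℝ), (∀ y, e y ∈ Set.Icc (0 : ℝ) 1) →
      (∀ y ∈ K, e y = 1) → ‖ofRealC₀ 𝕜 e * f - f‖ ≤ ε := by
  have h := f.zero_at_infty'.eventually (Metric.ball_mem_nhds 0 hε)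
  obtain ⟨K, hK, hKf⟩ := Filter.mem_cocompact.1 h
  refine ⟨K, hK, fun e he he1 => norm_le_of_forall_norm_le _ hε.le fun y => ?_⟩
  simp only [ZeroAtInftyContinuousMap.sub_apply, ZeroAtInftyContinuousMap.mul_apply,
    ofRealC₀_apply]
  by_cases hy : y ∈ K
  · simp [he1 y hy, hε.le]
  · have h1 : ‖f y‖ < ε := by simpa using hKf hy
    have h2 : (e y : 𝕜) * f y - f y = ((e y - 1 : ℝ) : 𝕜) * f y := by push_cast; ring
    rw [h2, norm_mul, RCLike.norm_ofReal]
    have h3 : |e y - 1| ≤ 1 := by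
      rw [abs_le]; constructor <;> linarith [(he y).1, (he y).2]
    nlinarith [norm_nonneg (f y)]

/-- Functions that are one on large compact sets form an approximate unit of `C₀(Ω)`, hence act as
one on the span of the products `f s`. Since they act as contractions, this passes to the closure of
the span, which is `Γ` by nondegeneracy. -/
theorem exists_compact_approx [T2Space Ω] [LocallyCompactSpace Ω] (s : Γ) {ε : ℝ} (hε : 0 < ε) :
    ∃ K : Set Ω, IsCompact K ∧ ∀ e : C₀(Ω, ℝ), (∀ y, e y ∈ Set.Icc (0 : ℝ) 1) →
      (∀ y ∈ K, e y = 1) → ‖ofRealC₀ 𝕜 e • s - s‖ ≤ ε := by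
  have key : ∀ t ∈ Submodule.span 𝕜 {t : Γ | ∃ (f : C₀(Ω, 𝕜)) (s : Γ), t = f • s},
      ∀ ε : ℝ, 0 < ε → ∃ K : Set Ω, IsCompact K ∧ ∀ e : C₀(Ω, ℝ),
      (∀ y, e y ∈ Set.Icc (0 : ℝ) 1) → (∀ y ∈ K, e y = 1) → ‖ofRealC₀ 𝕜 e • t - t‖ ≤ ε := by
    intro t ht
    induction ht using Submodule.span_induction with
    | mem t ht =>
      obtain ⟨f, r, rfl⟩ := ht
      intro ε hε
      obtain ⟨K, hK, h⟩ := exists_compact_approx_function f (ε := ε / (‖r‖ + 1)) (by positivity)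
      refine ⟨K, hK, fun e he he1 => ?_⟩
      rw [← mul_smul', ← sub_smul']
      refine (IsBanachModule.norm_smul_le (𝕜 := 𝕜) _ _).trans ?_
      calc _ ≤ ε / (‖r‖ + 1) * (‖r‖ + 1) := by
            gcongr
            · exact h e he he1
            · linarith
        _ = ε := by field_simp
    | zero => exact fun ε hε => ⟨∅, isCompact_empty, fun e _ _ => by simp [smul_zero', hε.le]⟩
    | add a b _ _ ha hb =>
      intro ε hε
      obtain ⟨K, hK, h⟩ := ha (ε / 2) (by positivity)
      obtain ⟨L, hL, h'⟩ := hb (ε / 2) (by positivity)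
      refine ⟨K ∪ L, hK.union hL, fun e he he1 => ?_⟩
      rw [smul_add', add_sub_add_comm]
      refine (norm_add_le _ _).trans ?_
      linarith [h e he fun y hy => he1 y (Or.inl hy), h' e he fun y hy => he1 y (Or.inr hy)]
    | smul c a _ ha =>
      intro ε hε
      obtain ⟨K, hK, h⟩ := ha (ε / (‖c‖ + 1)) (by positivity)
      refine ⟨K, hK, fun e he he1 => ?_⟩
      rw [smul_scalar', ← smul_sub, norm_smul]
      calc _ ≤ (‖c‖ + 1) * (ε / (‖c‖ + 1)) := by
            gcongr
            · linarith
            · exact h e he he1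
        _ = ε := by field_simp
  have hs : s ∈ closure (Submodule.span 𝕜 {t : Γ | ∃ (f : C₀(Ω, 𝕜)) (s : Γ), t = f • s} :
      Set Γ) := by
    rw [IsBanachModule.nondegenerate]; trivial
  obtain ⟨t, ht, hst⟩ := Metric.mem_closure_iff.1 hs (ε / 3) (by positivity)
  obtain ⟨K, hK, h⟩ := key t ht (ε / 3) (by positivity)
  refine ⟨K, hK, fun e he he1 => ?_⟩
  have h1 := norm_ofRealC₀_smul_le (𝕜 := 𝕜) e (s - t) he
  have h2 := h e he he1
  rw [dist_eq_norm] at hst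
  have h3 : ofRealC₀ 𝕜 e • s - s =
      ofRealC₀ 𝕜 e • (s - t) + (ofRealC₀ 𝕜 e • t - t) - (s - t) := by rw [smul_sub']; abel
  rw [h3]
  refine (norm_sub_le _ _).trans ?_
  linarith [norm_add_le (ofRealC₀ 𝕜 e • (s - t)) (ofRealC₀ 𝕜 e • t - t)]

/-! ### Suprema in cyclic submodules -/

/-- The positive part of `d` is the uniform limit of `θ d` with `θ = max (min (n d) 1) 0`, and
multiplication by `θ` is a contraction. The uniform error is at most `1 / n`, as it lives where `0 <
d < 1 / n`. -/
theorem norm_posPart_smul_le (d : C₀(Ω, ℝ)) (s : Γ) :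
    ‖ofRealC₀ 𝕜 (posPartC₀ d) • s‖ ≤ ‖ofRealC₀ 𝕜 d • s‖ := by
  refine le_of_forall_pos_le_add fun ε hε => ?_
  obtain ⟨n, hn⟩ : ∃ n : ℝ, 0 < n ∧ 1 / n * ‖s‖ ≤ ε :=
    ⟨(‖s‖ + 1) / ε, by positivity, by
      rw [one_div, inv_div, div_mul_eq_mul_div, div_le_iff₀ (by positivity)]
      nlinarith [norm_nonneg s]⟩
  let θ : C₀(Ω, ℝ) := postcompC₀ ⟨fun t => max (min (n * t) 1) 0, by fun_prop⟩ (by simp) d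
  have hθ : ∀ x, θ x ∈ Set.Icc (0 : ℝ) 1 := fun x => ⟨le_max_right _ _, by simp [θ]⟩
  have h1 := norm_ofRealC₀_smul_le (𝕜 := 𝕜) θ (ofRealC₀ 𝕜 d • s) hθ
  have h2 : ‖(ofRealC₀ 𝕜 (posPartC₀ d) - ofRealC₀ 𝕜 θ * ofRealC₀ 𝕜 d) • s‖ ≤ 1 / n * ‖s‖ := by
    refine norm_smul_le_of_forall_norm_le _ s (by simpa using hn.1.le) fun x => ?_
    have : (ofRealC₀ 𝕜 (posPartC₀ d) - ofRealC₀ 𝕜 θ * ofRealC₀ 𝕜 d) x =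
        ((max (d x) 0 - max (min (n * d x) 1) 0 * d x : ℝ) : 𝕜) := by
      simp [θ]
    rw [this, RCLike.norm_ofReal]
    rcases le_total (d x) 0 with h0 | h0
    · have : n * d x ≤ 0 := mul_nonpos_of_nonneg_of_nonpos hn.1.le h0
      rw [max_eq_right h0, min_eq_left (by linarith), max_eq_right this]
      simpa using hn.1.le
    · have h0' : 0 ≤ n * d x := mul_nonneg hn.1.le h0
      rw [max_eq_left h0]
      rcases le_total (n * d x) 1 with h3 | h3
      · have h4 : d x ≤ 1 / n := by rw [le_div_iff₀ hn.1]; linarith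
        rw [min_eq_left h3, max_eq_left h0', abs_of_nonneg] <;> nlinarith
      · rw [min_eq_right h3, max_eq_left zero_le_one]
        simpa using hn.1.le
  rw [sub_smul', mul_smul'] at h2
  have h3 := norm_sub_norm_le (ofRealC₀ 𝕜 (posPartC₀ d) • s)
    (ofRealC₀ 𝕜 θ • (ofRealC₀ 𝕜 d • s))
  linarith [hn.2]

/-- An upper bound `z` is close to both `(f + a) s` and `(g + b) s` with `a, b ≥ 0`. By
`norm_posPart_smul_le` it is then close to their pointwise maximum times `s`, and that maximum
dominates `f ∨ g`. -/
theorem isSupremum_smul (f g : C₀(Ω, ℝ)) (s : Γ) :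
    IsSupremum 𝕜 Ω s (ofRealC₀ 𝕜 f • s) (ofRealC₀ 𝕜 g • s) (ofRealC₀ 𝕜 (supC₀ f g) • s) := by
  have hsub : ∀ a b : C₀(Ω, ℝ), ofRealC₀ 𝕜 a • s - ofRealC₀ 𝕜 b • s = ofRealC₀ 𝕜 (a - b) • s :=
    fun a b => by
      rw [← sub_smul']
      congr 1
      ext x
      simp
  refine ⟨subset_closure ⟨_, rfl⟩, ?_, ?_, fun z _ h1 h2 => ?_⟩
  · rw [coneLE, hsub]
    exact ofRealC₀_smul_mem_positiveCone _ (fun x => by simp) s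
  · rw [coneLE, hsub]
    exact ofRealC₀_smul_mem_positiveCone _ (fun x => by simp) s
  · refine Metric.mem_closure_iff.2 fun ε hε => ?_
    obtain ⟨a, ha, hza⟩ := exists_of_mem_positiveCone h1 (ε := ε / 3) (by positivity)
    obtain ⟨b, hb, hzb⟩ := exists_of_mem_positiveCone h2 (ε := ε / 3) (by positivity)
    refine ⟨ofRealC₀ 𝕜 (supC₀ (f + a) (g + b) - supC₀ f g) • s, ⟨_, fun x => ⟨?_, by simp⟩, rfl⟩, ?_⟩
    · simp only [ofRealC₀_apply, ZeroAtInftyContinuousMap.sub_apply, supC₀_apply,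
        ZeroAtInftyContinuousMap.add_apply, RCLike.ofReal_re, sub_nonneg]
      exact max_le_max (by linarith [ha x]) (by linarith [hb x])
    · have hadd : ∀ a b : C₀(Ω, ℝ), ofRealC₀ 𝕜 (a + b) • s = ofRealC₀ 𝕜 a • s + ofRealC₀ 𝕜 b • s :=
        fun a b => by
          rw [← add_smul']
          congr 1
          ext x
          simp
      have h3 := norm_posPart_smul_le (𝕜 := 𝕜) (g + b - (f + a)) s
      rw [← hsub (g + b), hadd, hadd] at h3
      have h4 : ofRealC₀ 𝕜 g • s + ofRealC₀ 𝕜 b • s - (ofRealC₀ 𝕜 f • s + ofRealC₀ 𝕜 a • s) =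
        (z - ofRealC₀ 𝕜 f • s - ofRealC₀ 𝕜 a • s) - (z - ofRealC₀ 𝕜 g • s - ofRealC₀ 𝕜 b • s) := by
        abel
      rw [h4] at h3
      have h5 := norm_sub_le (z - ofRealC₀ 𝕜 f • s - ofRealC₀ 𝕜 a • s)
        (z - ofRealC₀ 𝕜 g • s - ofRealC₀ 𝕜 b • s)
      rw [dist_eq_norm, ← hsub, show supC₀ (f + a) (g + b) = f + a + posPartC₀ (g + b - (f + a))
        from rfl, hadd, hadd]
      have h6 : z - ofRealC₀ 𝕜 (supC₀ f g) • s - (ofRealC₀ 𝕜 f • s + ofRealC₀ 𝕜 a • s +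
          ofRealC₀ 𝕜 (posPartC₀ (g + b - (f + a))) • s - ofRealC₀ 𝕜 (supC₀ f g) • s) =
          (z - ofRealC₀ 𝕜 f • s - ofRealC₀ 𝕜 a • s) -
            ofRealC₀ 𝕜 (posPartC₀ (g + b - (f + a))) • s := by abel
      rw [h6]
      have h7 := norm_sub_le (z - ofRealC₀ 𝕜 f • s - ofRealC₀ 𝕜 a • s)
        (ofRealC₀ 𝕜 (posPartC₀ (g + b - (f + a))) • s)
      linarith

/-- The AM hypothesis enters the construction only through this identity. -/
theorem IsAMModule.norm_sup_smul (hΓ : IsAMModule 𝕜 Ω Γ) (f g : C₀(Ω, ℝ)) (hf : ∀ x, 0 ≤ f x)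
    (hg : ∀ x, 0 ≤ g x) (s : Γ) : ‖ofRealC₀ 𝕜 (supC₀ f g) • s‖ =
      max ‖ofRealC₀ 𝕜 f • s‖ ‖ofRealC₀ 𝕜 g • s‖ :=
  hΓ s _ (ofRealC₀_smul_mem_positiveCone f hf s) _ (ofRealC₀_smul_mem_positiveCone g hg s) _
    (isSupremum_smul f g s)

end Module

/-! ### The bundle of localizations of a Banach module -/

section Localization

variable {𝕜 : Type*} [RCLike 𝕜] {Ω : Type u} [TopologicalSpace Ω] [T2Space Ω]
  [LocallyCompactSpace Ω] {Γ : Type v} [NormedAddCommGroup Γ] [NormedSpace 𝕜 Γ]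
  [SMul C₀(Ω, 𝕜) Γ] [IsBanachModule 𝕜 C₀(Ω, 𝕜) Γ]

variable (𝕜 Γ) in
/-- The closed submodule of all elements of `Γ` that vanish at the point `x`. -/
def localKernel (x : Ω) : Submodule 𝕜 Γ where
  carrier := {s | ∀ ε : ℝ, 0 < ε → ∃ φ : C₀(Ω, ℝ), IsBump x φ ∧ ‖ofRealC₀ 𝕜 φ • s‖ < ε}
  zero_mem' := fun ε hε => by
    obtain ⟨φ, hφ, -⟩ := exists_isBump (x := x) Filter.univ_mem
    exact ⟨φ, hφ, by simpa [smul_zero'] using hε⟩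
  add_mem' := by
    intro s t hs ht ε hε
    obtain ⟨φ, hφ, h1⟩ := hs (ε / 2) (by positivity)
    obtain ⟨ψ, hψ, h2⟩ := ht (ε / 2) (by positivity)
    refine ⟨φ * ψ, hφ.mul hψ, ?_⟩
    have e1 : ofRealC₀ 𝕜 (φ * ψ) = ofRealC₀ 𝕜 φ * ofRealC₀ 𝕜 ψ := by ext y; simp
    have e2 : ofRealC₀ 𝕜 (φ * ψ) = ofRealC₀ 𝕜 ψ * ofRealC₀ 𝕜 φ := by rw [e1, mul_comm]
    have h3 := norm_ofRealC₀_smul_le (𝕜 := 𝕜) ψ (ofRealC₀ 𝕜 φ • s) hψ.mem_Icc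
    have h4 := norm_ofRealC₀_smul_le (𝕜 := 𝕜) φ (ofRealC₀ 𝕜 ψ • t) hφ.mem_Icc
    rw [← mul_smul', ← e2] at h3
    rw [← mul_smul', ← e1] at h4
    rw [smul_add']
    linarith [norm_add_le (ofRealC₀ 𝕜 (φ * ψ) • s) (ofRealC₀ 𝕜 (φ * ψ) • t)]
  smul_mem' := by
    intro c s hs ε hε
    obtain ⟨φ, hφ, h1⟩ := hs (ε / (‖c‖ + 1)) (by positivity)
    refine ⟨φ, hφ, ?_⟩
    rw [smul_scalar', norm_smul]
    calc _ ≤ (‖c‖ + 1) * ‖ofRealC₀ 𝕜 φ • s‖ := by gcongr; linarith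
      _ < (‖c‖ + 1) * (ε / (‖c‖ + 1)) := by gcongr
      _ = ε := by field_simp

instance isClosed_localKernel (x : Ω) : IsClosed (localKernel 𝕜 Γ x : Set Γ) := by
  refine isClosed_of_closure_subset fun s hs ε hε => ?_
  obtain ⟨t, ht, hst⟩ := Metric.mem_closure_iff.1 hs (ε / 2) (by positivity)
  obtain ⟨φ, hφ, h⟩ := ht (ε / 2) (by positivity)
  refine ⟨φ, hφ, ?_⟩
  have h1 := norm_ofRealC₀_smul_le (𝕜 := 𝕜) φ (s - t) hφ.mem_Icc
  rw [dist_eq_norm] at hst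
  have h2 : ofRealC₀ 𝕜 φ • s = ofRealC₀ 𝕜 φ • (s - t) + ofRealC₀ 𝕜 φ • t := by
    rw [smul_sub']; abel
  rw [h2]
  linarith [norm_add_le (ofRealC₀ 𝕜 φ • (s - t)) (ofRealC₀ 𝕜 φ • t)]

variable (𝕜 Ω Γ) in
/-- The localization of `Γ` at `x`. -/
abbrev LocalFiber (x : Ω) : Type v := Γ ⧸ localKernel 𝕜 Γ x

variable (𝕜) in
/-- The value of `s` at the point `x`. -/
def localValue (x : Ω) : Γ →ₗ[𝕜] LocalFiber 𝕜 Ω Γ x := (localKernel 𝕜 Γ x).mkQ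

theorem localValue_surjective (x : Ω) : Function.Surjective (localValue 𝕜 x (Γ := Γ)) :=
  Submodule.mkQ_surjective _

theorem localValue_eq_iff {x : Ω} {s t : Γ} :
    localValue 𝕜 x s = localValue 𝕜 x t ↔ s - t ∈ localKernel 𝕜 Γ x :=
  Submodule.Quotient.eq _

theorem norm_localValue_le (x : Ω) (s : Γ) : ‖localValue 𝕜 x s‖ ≤ ‖s‖ :=
  Submodule.Quotient.norm_mk_le _ s

/-- Near `x` the function `f - f x` is small, so a bump supported there makes `f s - f(x) s` small.
-/
theorem localValue_smul (x : Ω) (f : C₀(Ω, 𝕜)) (s : Γ) :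
    localValue 𝕜 x (f • s) = f x • localValue 𝕜 x s := by
  rw [← map_smul, localValue_eq_iff]
  intro ε hε
  have hδ : 0 < ε / (‖s‖ + 1) := by positivity
  have hU : {y | ‖f y - f x‖ < ε / (‖s‖ + 1)} ∈ 𝓝 x := by
    filter_upwards [((map_continuous f).tendsto x).eventually (Metric.ball_mem_nhds (f x) hδ)]
      with y hy
    simpa only [Metric.mem_ball, dist_eq_norm] using hy
  obtain ⟨φ, hφ, -, hφU⟩ := exists_isBump hU
  refine ⟨φ, hφ, ?_⟩
  rw [smul_sub', smul_scalar', ← mul_smul', ← scalar_smul', ← sub_smul']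
  refine (norm_smul_le_of_forall_norm_le _ s hδ.le fun y => ?_).trans_lt ?_
  · have e : (ofRealC₀ 𝕜 φ * f - f x • ofRealC₀ 𝕜 φ) y = (φ y : 𝕜) * (f y - f x) := by
      simp; ring
    rw [e, norm_mul, RCLike.norm_ofReal, abs_of_nonneg (hφ.mem_Icc y).1]
    by_cases hy : y ∈ tsupport φ
    · have h1 : ‖f y - f x‖ < _ := hφU hy
      nlinarith [(hφ.mem_Icc y).1, (hφ.mem_Icc y).2, norm_nonneg (f y - f x)]
    · rw [image_eq_zero_of_notMem_tsupport hy, zero_mul]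
      exact hδ.le
  · rw [div_mul_eq_mul_div, div_lt_iff₀ (by positivity)]
    nlinarith

theorem IsBump.localValue_smul {x : Ω} {φ : C₀(Ω, ℝ)} (hφ : IsBump x φ) (s : Γ) :
    localValue 𝕜 x (ofRealC₀ 𝕜 φ • s) = localValue 𝕜 x s := by
  rw [RepBundle.localValue_smul, ofRealC₀_apply, hφ.eventually_eq_one.self_of_nhds,
    RCLike.ofReal_one, one_smul]

/-- Turns the quotient norm into a bound near `x`: take a representative `t` of almost minimal norm
and a bump that makes `s - t` small. -/
theorem exists_isBump_of_norm_localValue_lt {x : Ω} {s : Γ} {M : ℝ}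
    (h : ‖localValue 𝕜 x s‖ < M) : ∃ φ : C₀(Ω, ℝ), IsBump x φ ∧ ‖ofRealC₀ 𝕜 φ • s‖ < M := by
  set ε := (M - ‖localValue 𝕜 x s‖) / 2 with hε
  have hε0 : 0 < ε := by rw [hε]; linarith
  obtain ⟨t, ht, htn⟩ := Submodule.Quotient.norm_mk_lt (localValue 𝕜 x s) hε0
  obtain ⟨φ, hφ, h1⟩ := localValue_eq_iff.1 ht.symm ε hε0
  refine ⟨φ, hφ, ?_⟩
  have h2 := norm_ofRealC₀_smul_le (𝕜 := 𝕜) φ t hφ.mem_Icc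
  have h3 : ofRealC₀ 𝕜 φ • s = ofRealC₀ 𝕜 φ • (s - t) + ofRealC₀ 𝕜 φ • t := by
    rw [smul_sub']; abel
  rw [h3]
  linarith [norm_add_le (ofRealC₀ 𝕜 φ • (s - t)) (ofRealC₀ 𝕜 φ • t)]

theorem IsAMModule.norm_le_of_forall_norm_localValue_lt (hΓ : IsAMModule 𝕜 Ω Γ) {s : Γ} {M : ℝ}
    (hM : 0 ≤ M) (h : ∀ x : Ω, ‖localValue 𝕜 x s‖ < M) : ‖s‖ ≤ M := by
  choose φ hφ hφs using fun x => exists_isBump_of_norm_localValue_lt (h x)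
  -- `Φ` is the pointwise maximum of the bumps `φ x` for `x ∈ I`.
  have key : ∀ I : Finset Ω, ∃ Φ : C₀(Ω, ℝ), (∀ y, Φ y ∈ Set.Icc (0 : ℝ) 1) ∧
      (∀ x ∈ I, ∀ y, φ x y = 1 → Φ y = 1) ∧ ‖ofRealC₀ 𝕜 Φ • s‖ ≤ M := by
    classical
    intro I
    induction I using Finset.induction_on with
    | empty =>
      refine ⟨0, by simp, by simp, ?_⟩
      have : ofRealC₀ 𝕜 (0 : C₀(Ω, ℝ)) = 0 := by ext; simp
      rwa [this, zero_smul', norm_zero]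
    | insert x I _ ih =>
      obtain ⟨Φ, h1, h2, h3⟩ := ih
      refine ⟨supC₀ (φ x) Φ, fun y => ?_, fun z hz y hy => ?_, ?_⟩
      · rw [supC₀_apply]
        exact ⟨le_max_of_le_right (h1 y).1, max_le ((hφ x).mem_Icc y).2 (h1 y).2⟩
      · rw [supC₀_apply]
        rcases Finset.mem_insert.1 hz with rfl | hz
        · rw [hy, max_eq_left (h1 y).2]
        · rw [h2 z hz y hy, max_eq_right ((hφ x).mem_Icc y).2]
      · rw [hΓ.norm_sup_smul _ _ (fun y => ((hφ x).mem_Icc y).1) (fun y => (h1 y).1)]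
        exact max_le (hφs x).le h3
  refine le_of_forall_pos_le_add fun ε hε => ?_
  obtain ⟨K, hK, hKs⟩ := exists_compact_approx (𝕜 := 𝕜) (Ω := Ω) s hε
  obtain ⟨I, -, hI⟩ := hK.elim_nhds_subcover (fun x => {y | φ x y = 1})
    (fun x _ => (hφ x).eventually_eq_one)
  obtain ⟨Φ, h1, h2, h3⟩ := key I
  have h4 := hKs Φ h1 fun y hy => by
    obtain ⟨x, hx, hxy⟩ := Set.mem_iUnion₂.1 (hI hy)
    exact h2 x hx y hxy
  have h5 := norm_sub_norm_le s (ofRealC₀ 𝕜 Φ • s)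
  rw [norm_sub_rev] at h5
  linarith

/-- The map that sends a point and an element of `Γ` to the value at the point. -/
def totalValue (p : Ω × Γ) : Bundle.TotalSpace PUnit.{1} (LocalFiber 𝕜 Ω Γ) :=
  ⟨p.1, localValue 𝕜 p.1 p.2⟩

instance : TopologicalSpace (Bundle.TotalSpace PUnit.{1} (LocalFiber 𝕜 Ω Γ)) :=
  TopologicalSpace.coinduced totalValue inferInstance

theorem totalValue_surjective : Function.Surjective (totalValue (𝕜 := 𝕜) (Ω := Ω) (Γ := Γ)) := by
  rintro ⟨x, a⟩
  obtain ⟨s, rfl⟩ := localValue_surjective x a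
  exact ⟨(x, s), rfl⟩

theorem totalValue_eq_iff {p : Ω × Γ} {y : Ω} {t : Γ} :
    totalValue p = totalValue (𝕜 := 𝕜) (y, t) ↔
      p.1 = y ∧ localValue 𝕜 y p.2 = localValue 𝕜 y t := by
  obtain ⟨x, s⟩ := p
  constructor
  · intro h
    obtain rfl : x = y := congrArg Bundle.TotalSpace.proj h
    refine ⟨rfl, ?_⟩
    simpa [totalValue] using h
  · rintro ⟨rfl, h⟩
    simp only at h
    simp [totalValue, h]

/-- If `s` and `t` agree at `x`, some bump `φ` makes `φ (t - s)` small. Then `s + φ (t - s)` is near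
`s` but has the values of `t` around `x`, so neighborhoods of `(x, s)` and `(x, t)` have matching
images. -/
theorem isOpenQuotientMap_totalValue :
    IsOpenQuotientMap (totalValue (𝕜 := 𝕜) (Ω := Ω) (Γ := Γ)) := by
  refine ⟨totalValue_surjective, continuous_coinduced_rng, fun W hW => ?_⟩
  rw [isOpen_coinduced, isOpen_iff_mem_nhds]
  rintro ⟨y, t⟩ ⟨⟨x, s⟩, hs, hst⟩
  obtain ⟨rfl, hst⟩ := totalValue_eq_iff.1 hst
  simp only at hst hs
  have hW' := hW.mem_nhds hs
  rw [nhds_prod_eq, Filter.mem_prod_iff] at hW'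
  obtain ⟨U, hU, V, hV, hUV⟩ := hW'
  obtain ⟨r, hr, hrV⟩ := Metric.mem_nhds_iff.1 hV
  obtain ⟨φ, hφ, hn⟩ := localValue_eq_iff.1 hst.symm (r / 2) (by positivity)
  have h1 : {y | IsBump y φ} ∩ U ∈ 𝓝 x := Filter.inter_mem hφ.eventually hU
  filter_upwards [prod_mem_nhds h1 (Metric.ball_mem_nhds t (half_pos hr))]
  rintro ⟨y, t'⟩ ⟨⟨hy, hyU⟩, ht'⟩
  refine ⟨(y, s + (t' - t) + ofRealC₀ 𝕜 φ • (t - s)), hUV ⟨hyU, hrV ?_⟩,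
    totalValue_eq_iff.2 ⟨rfl, ?_⟩⟩
  · rw [Metric.mem_ball, dist_eq_norm] at ht' ⊢
    have : s + (t' - t) + ofRealC₀ 𝕜 φ • (t - s) - s = (t' - t) + ofRealC₀ 𝕜 φ • (t - s) := by abel
    rw [this]
    linarith [norm_add_le (t' - t) (ofRealC₀ 𝕜 φ • (t - s))]
  · have hy' : IsBump y φ := hy
    simp only [map_add, hy'.localValue_smul, map_sub]
    abel

theorem eventually_norm_localValue_lt {x : Ω} {s : Γ} {M : ℝ} (h : ‖localValue 𝕜 x s‖ < M) :
    ∀ᶠ p in 𝓝 (x, s), ‖localValue 𝕜 p.1 p.2‖ < M := by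
  obtain ⟨φ, hφ, hn⟩ := exists_isBump_of_norm_localValue_lt h
  rw [nhds_prod_eq]
  filter_upwards [Filter.prod_mem_prod hφ.eventually
    (Metric.ball_mem_nhds s (sub_pos.2 hn))]
  rintro ⟨y, t⟩ ⟨hy, ht⟩
  have hy' : IsBump y φ := hy
  rw [Metric.mem_ball, dist_eq_norm] at ht
  have h1 := norm_ofRealC₀_smul_le (𝕜 := 𝕜) φ (t - s) hy'.mem_Icc
  have h2 := norm_localValue_le (𝕜 := 𝕜) y (ofRealC₀ 𝕜 φ • t)
  rw [hy'.localValue_smul] at h2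
  have h3 : ofRealC₀ 𝕜 φ • t = ofRealC₀ 𝕜 φ • (t - s) + ofRealC₀ 𝕜 φ • s := by
    rw [smul_sub']; abel
  rw [h3] at h2
  change ‖localValue 𝕜 y t‖ < M
  linarith [norm_add_le (ofRealC₀ 𝕜 φ • (t - s)) (ofRealC₀ 𝕜 φ • s)]

/-- Continuity of addition in terms of neighborhoods: the fiber product is not a product, so the
quotient map cannot be applied to it factorwise. -/
theorem exists_nhds_add {x : Ω} {s t : Γ}
    {W : Set (Bundle.TotalSpace PUnit.{1} (LocalFiber 𝕜 Ω Γ))}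
    (hW : W ∈ 𝓝 (⟨x, localValue 𝕜 x s + localValue 𝕜 x t⟩ :
      Bundle.TotalSpace PUnit.{1} (LocalFiber 𝕜 Ω Γ))) :
    ∃ A ∈ 𝓝 (totalValue (𝕜 := 𝕜) (x, s)), ∃ B ∈ 𝓝 (totalValue (𝕜 := 𝕜) (x, t)),
      ∀ (y : Ω) (a b : LocalFiber 𝕜 Ω Γ y), ⟨y, a⟩ ∈ A → ⟨y, b⟩ ∈ B → ⟨y, a + b⟩ ∈ W := by
  have h : totalValue (𝕜 := 𝕜) ⁻¹' W ∈ 𝓝 (x, s + t) :=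
    isOpenQuotientMap_totalValue.continuous.continuousAt.preimage_mem_nhds
      (by simpa [totalValue] using hW)
  rw [nhds_prod_eq, Filter.mem_prod_iff] at h
  obtain ⟨U, hU, V, hV, hUV⟩ := h
  have hV' : (fun p : Γ × Γ => p.1 + p.2) ⁻¹' V ∈ 𝓝 (s, t) :=
    (continuous_add.tendsto (s, t)).eventually hV
  obtain ⟨A, hA, B, hB, hAB⟩ := mem_nhds_prod_iff.1 hV'
  have hopen : ∀ (r : Γ) (C : Set Γ), C ∈ 𝓝 r →
      totalValue (𝕜 := 𝕜) '' (U ×ˢ C) ∈ 𝓝 (totalValue (𝕜 := 𝕜) (x, r)) := fun r C hC =>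
    isOpenQuotientMap_totalValue.isOpenMap.image_mem_nhds (prod_mem_nhds hU hC)
  refine ⟨_, hopen s A hA, _, hopen t B hB, ?_⟩
  rintro y a b ⟨⟨y', s'⟩, hs', hsa⟩ ⟨⟨y'', t'⟩, ht', htb⟩
  obtain ⟨a, rfl⟩ := localValue_surjective y a
  obtain ⟨b, rfl⟩ := localValue_surjective y b
  have hb := totalValue_eq_iff.1 (show _ = totalValue (𝕜 := 𝕜) (y, b) from htb)
  obtain ⟨rfl, ha⟩ := totalValue_eq_iff.1 (show _ = totalValue (𝕜 := 𝕜) (y, a) from hsa)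
  obtain ⟨rfl, hb⟩ := hb
  simp only at ha hb
  have h : totalValue (𝕜 := 𝕜) (y'', s' + t') ∈ W := hUV ⟨hs'.1, hAB (Set.mk_mem_prod hs'.2 ht'.2)⟩
  rwa [totalValue, map_add, ha, hb] at h

variable (𝕜 Ω Γ) in
/-- The Banach bundle of localizations of a Banach module. -/
def localizationBundle [CompleteSpace Γ] : BanachBundle.{u, v} 𝕜 Ω where
  Fiber := LocalFiber 𝕜 Ω Γ
  continuous_proj := isOpenQuotientMap_totalValue.continuous_comp_iff.1 continuous_fst
  isOpenMap_proj W hW := by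
    have : (fun p : Bundle.TotalSpace PUnit.{1} (LocalFiber 𝕜 Ω Γ) => p.proj) '' W =
        Prod.fst '' (totalValue (𝕜 := 𝕜) (Ω := Ω) (Γ := Γ) ⁻¹' W) := by
      conv_lhs => rw [← Set.image_preimage_eq W totalValue_surjective, Set.image_image]
      rfl
    rw [this]
    exact isOpenMap_fst _ (hW.preimage isOpenQuotientMap_totalValue.continuous)
  continuous_add := by
    let _ : TopologicalSpace (Σ x, LocalFiber 𝕜 Ω Γ x × LocalFiber 𝕜 Ω Γ x) :=
      TopologicalSpace.induced (fun q => ((⟨q.1, q.2.1⟩, ⟨q.1, q.2.2⟩) :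
        Bundle.TotalSpace PUnit.{1} (LocalFiber 𝕜 Ω Γ) ×
          Bundle.TotalSpace PUnit.{1} (LocalFiber 𝕜 Ω Γ))) inferInstance
    refine continuous_iff_continuousAt.2 ?_
    rintro ⟨x, a, b⟩
    obtain ⟨s, rfl⟩ := localValue_surjective x a
    obtain ⟨t, rfl⟩ := localValue_surjective x b
    intro W hW
    obtain ⟨A, hA, B, hB, h⟩ := exists_nhds_add hW
    rw [Filter.mem_map, nhds_induced, Filter.mem_comap]
    exact ⟨A ×ˢ B, prod_mem_nhds hA hB, fun q hq => h _ _ _ hq.1 hq.2⟩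
  continuous_smul := by
    refine ((IsOpenQuotientMap.id (X := 𝕜)).prodMap
      isOpenQuotientMap_totalValue).continuous_comp_iff.1 ?_
    have : Continuous fun q : 𝕜 × (Ω × Γ) => totalValue (𝕜 := 𝕜) (q.2.1, q.1 • q.2.2) :=
      isOpenQuotientMap_totalValue.continuous.comp (by fun_prop)
    refine this.congr fun q => ?_
    simp only [Function.comp_apply, Prod.map, id, totalValue, map_smul]
    rfl
  upperSemicontinuous_norm := by
    intro p M hM
    obtain ⟨⟨x, s⟩, rfl⟩ := totalValue_surjective p
    rw [← isOpenQuotientMap_totalValue.map_nhds_eq]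
    exact eventually_norm_localValue_lt hM
  zero_nhds := by
    intro x W hW hx
    have h : (x, (0 : Γ)) ∈ totalValue (𝕜 := 𝕜) ⁻¹' W := by simpa [totalValue] using hx
    have h' := (hW.preimage isOpenQuotientMap_totalValue.continuous).mem_nhds h
    rw [nhds_prod_eq, Filter.mem_prod_iff] at h'
    obtain ⟨U, hU, V, hV, hUV⟩ := h'
    obtain ⟨r, hr, hrV⟩ := Metric.mem_nhds_iff.1 hV
    obtain ⟨U', hU'U, hU', hxU'⟩ := mem_nhds_iff.1 hU
    refine ⟨r / 2, half_pos hr, U', hU', hxU', ?_⟩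
    rintro ⟨y, a⟩ hy ha
    -- Lifting may increase the norm by less than `r / 2`, so the lift stays in the ball of radius
    -- `r`.
    obtain ⟨s, rfl, hs⟩ := Submodule.Quotient.norm_mk_lt a (half_pos hr)
    have hsV : s ∈ V := hrV (by
      rw [mem_ball_zero_iff]
      simp only at ha
      linarith)
    have hsU : (y, s) ∈ U ×ˢ V := ⟨hU'U hy, hsV⟩
    exact hUV hsU

end Localization

/-! ### General facts on bundles and their sections -/

namespace BanachBundle

variable {𝕜 : Type*} [RCLike 𝕜] {Ω : Type u} [TopologicalSpace Ω] (E : BanachBundle.{u, v} 𝕜 Ω)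

theorem exists_nhds_add {x : Ω} {a b : E.Fiber x} {W : Set E.Total}
    (hW : W ∈ 𝓝 (⟨x, a + b⟩ : E.Total)) :
    ∃ A ∈ 𝓝 (⟨x, a⟩ : E.Total), ∃ B ∈ 𝓝 (⟨x, b⟩ : E.Total),
      ∀ (y : Ω) (a b : E.Fiber y), ⟨y, a⟩ ∈ A → ⟨y, b⟩ ∈ B → ⟨y, a + b⟩ ∈ W := by
  let _ : TopologicalSpace (Σ x, E.Fiber x × E.Fiber x) := TopologicalSpace.induced
    (fun q => ((⟨q.1, q.2.1⟩, ⟨q.1, q.2.2⟩) : E.Total × E.Total)) inferInstance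
  have h := (continuous_iff_continuousAt.1 E.continuous_add ⟨x, a, b⟩) hW
  rw [Filter.mem_map, nhds_induced, Filter.mem_comap] at h
  obtain ⟨S, hS, hSW⟩ := h
  obtain ⟨A, hA, B, hB, hAB⟩ := mem_nhds_prod_iff.1 hS
  exact ⟨A, hA, B, hB, fun y a b ha hb => hSW (a := ⟨y, a, b⟩) (hAB (Set.mk_mem_prod ha hb))⟩

theorem eventually_norm_lt {s : ∀ x, E.Fiber x} {x : Ω} (hs : ContinuousAt (E.toTotal s) x)
    {M : ℝ} (h : ‖s x‖ < M) : ∀ᶠ y in 𝓝 x, ‖s y‖ < M :=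
  hs.eventually (E.upperSemicontinuous_norm (E.toTotal s x) M h)

namespace SectionsZero

variable {E}

theorem norm_apply_le (s : E.SectionsZero) (x : Ω) : ‖s x‖ ≤ ‖s‖ := le_ciSup (bddAbove E s) x

theorem norm_le_of_forall {s : E.SectionsZero} {C : ℝ} (hC : 0 ≤ C) (h : ∀ x, ‖s x‖ ≤ C) :
    ‖s‖ ≤ C := Real.iSup_le h hC

theorem eventually_norm_lt (s : E.SectionsZero) {x : Ω} {M : ℝ} (h : ‖s x‖ < M) :
    ∀ᶠ y in 𝓝 x, ‖s y‖ < M :=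
  E.eventually_norm_lt s.2.1.continuousAt h

theorem smul_apply (f : C₀(Ω, 𝕜)) (s : E.SectionsZero) (x : Ω) : (f • s) x = f x • s x := rfl

theorem sub_apply (s t : E.SectionsZero) (x : Ω) : (s - t) x = s x - t x := rfl

end SectionsZero

end BanachBundle

/-! ### Representation of an AM-module by sections -/

section Representation

open BanachBundle

variable {𝕜 : Type*} [RCLike 𝕜] {Ω : Type u} [TopologicalSpace Ω] [T2Space Ω]
  [LocallyCompactSpace Ω] {Γ : Type v} [NormedAddCommGroup Γ] [NormedSpace 𝕜 Γ] [CompleteSpace Γ]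
  [SMul C₀(Ω, 𝕜) Γ] [IsBanachModule 𝕜 C₀(Ω, 𝕜) Γ]

/-- The missing weight `1 - ∑ c i` falls on the zero vector, which is harmless if it vanishes or if
`b` is itself within `ε` of zero. -/
theorem norm_sum_smul_sub_le {ι F : Type*} [NormedAddCommGroup F] [NormedSpace 𝕜 F] (I : Finset ι)
    (c : ι → ℝ) (hc : ∀ i, 0 ≤ c i) (hc1 : ∑ i ∈ I, c i ≤ 1) (a : ι → F) (b : F) {ε : ℝ}
    (h : ∀ i ∈ I, c i ≠ 0 → ‖a i - b‖ ≤ ε) (hb : ∑ i ∈ I, c i = 1 ∨ ‖b‖ ≤ ε) :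
    ‖∑ i ∈ I, (c i : 𝕜) • a i - b‖ ≤ ε := by
  have e : ∑ i ∈ I, (c i : 𝕜) • a i - b =
      ∑ i ∈ I, (c i : 𝕜) • (a i - b) - ((1 - ∑ i ∈ I, c i : ℝ) : 𝕜) • b := by
    simp only [smul_sub, Finset.sum_sub_distrib, ← Finset.sum_smul]
    push_cast
    rw [sub_smul, one_smul]
    abel
  have h1 : ‖∑ i ∈ I, (c i : 𝕜) • (a i - b)‖ ≤ (∑ i ∈ I, c i) * ε := by
    rw [Finset.sum_mul]
    refine norm_sum_le_of_le _ fun i hi => ?_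
    rw [norm_smul, RCLike.norm_ofReal, abs_of_nonneg (hc i)]
    by_cases h0 : c i = 0
    · simp [h0]
    · exact mul_le_mul_of_nonneg_left (h i hi h0) (hc i)
  have h2 : ‖((1 - ∑ i ∈ I, c i : ℝ) : 𝕜) • b‖ ≤ (1 - ∑ i ∈ I, c i) * ε := by
    rw [norm_smul, RCLike.norm_ofReal, abs_of_nonneg (by linarith)]
    rcases hb with hb | hb
    · simp [hb]
    · exact mul_le_mul_of_nonneg_left hb (by linarith)
  rw [e]
  refine (norm_sub_le _ _).trans ((add_le_add h1 h2).trans (le_of_eq (by ring)))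

variable (𝕜 Ω) in
/-- The section of the bundle of localizations that is defined by an element of the module. -/
def toSection (s : Γ) : (localizationBundle 𝕜 Ω Γ).SectionsZero :=
  ⟨fun x => localValue 𝕜 x s, isOpenQuotientMap_totalValue.continuous.comp
    (Continuous.prodMk_left s), fun ε hε => by
    obtain ⟨K, hK, h⟩ := exists_compact_approx (𝕜 := 𝕜) (Ω := Ω) s hε
    obtain ⟨e, he, he1, hec, -⟩ := exists_compact_bump hK isOpen_univ (Set.subset_univ K)
    refine ⟨tsupport e, hec, fun x hx => ?_⟩
    have h1 : localValue 𝕜 x (ofRealC₀ 𝕜 e • s) = 0 := by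
      rw [localValue_smul, ofRealC₀_apply, image_eq_zero_of_notMem_tsupport hx, RCLike.ofReal_zero,
        zero_smul]
    have h2 := (norm_localValue_le (𝕜 := 𝕜) x (ofRealC₀ 𝕜 e • s - s)).trans (h e he he1)
    rwa [map_sub, h1, zero_sub, norm_neg] at h2⟩

theorem toSection_apply (s : Γ) (x : Ω) : toSection 𝕜 Ω s x = localValue 𝕜 x s := rfl

theorem IsAMModule.norm_toSection (hΓ : IsAMModule 𝕜 Ω Γ) (s : Γ) : ‖toSection 𝕜 Ω s‖ = ‖s‖ := by
  refine le_antisymm (SectionsZero.norm_le_of_forall (norm_nonneg s)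
    fun x => norm_localValue_le x s) (le_of_forall_pos_le_add fun ε hε => ?_)
  refine hΓ.norm_le_of_forall_norm_localValue_lt (by positivity) fun x => ?_
  exact (SectionsZero.norm_apply_le (toSection 𝕜 Ω s) x).trans_lt (lt_add_of_pos_right _ hε)

variable (𝕜 Ω Γ) in
/-- The canonical linear map from a module to the sections of its bundle of localizations. -/
def toSectionLinear : Γ →ₗ[𝕜] (localizationBundle 𝕜 Ω Γ).SectionsZero where
  toFun := toSection 𝕜 Ω
  map_add' s t := Subtype.ext (funext fun x => map_add (localValue 𝕜 x) s t)
  map_smul' c s := Subtype.ext (funext fun x => map_smul (localValue 𝕜 x) c s)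

/-- Elements with the right value at one point approximate `t` nearby by upper semicontinuity; a
partition of unity on a compact set off which `t` is small glues them. This needs no AM hypothesis.
-/
theorem exists_norm_toSection_sub_le (t : (localizationBundle 𝕜 Ω Γ).SectionsZero) {ε : ℝ}
    (hε : 0 < ε) : ∃ s : Γ, ‖toSection 𝕜 Ω s - t‖ ≤ ε := by
  obtain ⟨K, hK, hKt⟩ := t.2.2 ε hε
  choose σ hσ using fun x => localValue_surjective (𝕜 := 𝕜) (Γ := Γ) x (t x)
  have hU : ∀ x, {y | ‖(toSection 𝕜 Ω (σ x) - t) y‖ < ε} ∈ 𝓝 x := fun x =>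
    SectionsZero.eventually_norm_lt _ (by
      rw [SectionsZero.sub_apply, toSection_apply, hσ, sub_self, norm_zero]
      exact hε)
  obtain ⟨I, φ, h1, h2, h3, h4, h5⟩ := exists_finset_partition hK
    (fun x => interior {y | ‖(toSection 𝕜 Ω (σ x) - t) y‖ < ε}) (fun x => isOpen_interior)
    (fun x _ => Set.mem_iUnion.2 ⟨x, mem_interior_iff_mem_nhds.2 (hU x)⟩)
  refine ⟨∑ i ∈ I, ofRealC₀ 𝕜 (compactC₀ (φ i) (h2 i)) • σ i,
    SectionsZero.norm_le_of_forall hε.le fun x => ?_⟩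
  rw [SectionsZero.sub_apply, toSection_apply]
  have e : localValue 𝕜 x (∑ i ∈ I, ofRealC₀ 𝕜 (compactC₀ (φ i) (h2 i)) • σ i) =
      ∑ i ∈ I, (φ i x : 𝕜) • localValue 𝕜 x (σ i) := by
    simp only [map_sum, localValue_smul, ofRealC₀_apply, compactC₀_apply]
  rw [e]
  refine norm_sum_smul_sub_le I (fun i => φ i x) (fun i => h3 i x) (h4 x) _ _ (fun i _ hi => ?_) ?_
  · have hx := interior_subset (h1 i (subset_tsupport _ hi))
    exact le_of_lt hx
  · by_cases hx : x ∈ K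
    · exact Or.inl (h5 x hx)
    · exact Or.inr (hKt x hx)

theorem IsAMModule.isometricallyIsomorphic_sections (hΓ : IsAMModule 𝕜 Ω Γ) :
    IsometricallyIsomorphicModules 𝕜 C₀(Ω, 𝕜) Γ (localizationBundle 𝕜 Ω Γ).SectionsZero := by
  let T : Γ →ₗᵢ[𝕜] (localizationBundle 𝕜 Ω Γ).SectionsZero :=
    ⟨toSectionLinear 𝕜 Ω Γ, hΓ.norm_toSection⟩
  have hT : Function.Surjective T := by
    intro t
    -- The isometric image of the complete space `Γ` is closed, so density suffices.
    have hcl : IsClosed (Set.range T) := T.isometry.isClosedEmbedding.isClosed_range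
    refine hcl.closure_subset (Metric.mem_closure_iff.2 fun ε hε => ?_)
    obtain ⟨s, hs⟩ := exists_norm_toSection_sub_le t (half_pos hε)
    refine ⟨T s, ⟨s, rfl⟩, ?_⟩
    rw [dist_comm, dist_eq_norm]
    exact hs.trans_lt (half_lt_self hε)
  exact ⟨LinearIsometryEquiv.ofSurjective T hT, fun f s =>
    Subtype.ext (funext fun x => localValue_smul x f s)⟩

end Representation

/-! ### Existence of continuous sections through every point -/

namespace BanachBundle

variable {𝕜 : Type*} [RCLike 𝕜] {Ω : Type u} [TopologicalSpace Ω] (E : BanachBundle.{u, v} 𝕜 Ω)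

theorem continuousAt_smul {c : Ω → 𝕜} {s : ∀ x, E.Fiber x} {x : Ω} (hc : ContinuousAt c x)
    (hs : ContinuousAt (E.toTotal s) x) : ContinuousAt (E.toTotal fun y => c y • s y) x :=
  ContinuousAt.comp (f := fun y => (c y, E.toTotal s y)) E.continuous_smul.continuousAt
    (hc.prodMk hs)

/-- Every point of a Banach bundle has an `ε`-thin open neighborhood. -/
theorem exists_thin_nhds {x : Ω} (a : E.Fiber x) {ε : ℝ} (hε : 0 < ε) :
    ∃ W ∈ 𝓝 (⟨x, a⟩ : E.Total), ∀ (y : Ω) (b c : E.Fiber y),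
      ⟨y, b⟩ ∈ W → ⟨y, c⟩ ∈ W → ‖b - c‖ < ε := by
  have h0 : {p : E.Total | ‖p.snd‖ < ε} ∈ 𝓝 (⟨x, a + (-1 : 𝕜) • a⟩ : E.Total) :=
    E.upperSemicontinuous_norm _ ε (by simpa using hε)
  obtain ⟨A, hA, B, hB, h⟩ := E.exists_nhds_add h0
  have hB' : {p : E.Total | (⟨p.proj, (-1 : 𝕜) • p.snd⟩ : E.Total) ∈ B} ∈ 𝓝 (⟨x, a⟩ : E.Total) :=
    (E.continuous_smul.comp (Continuous.prodMk_right (-1 : 𝕜))).continuousAt.preimage_mem_nhds hB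
  refine ⟨_, Filter.inter_mem hA hB', fun y b c hb hc => ?_⟩
  have h1 := h y b ((-1 : 𝕜) • c) hb.1 hc.2
  simpa [sub_eq_add_neg] using h1

/-- `f` is continuous at `x` up to the error `ε`. -/
def AlmostContinuousAt (f : ∀ x, E.Fiber x) (ε : ℝ) (x : Ω) : Prop :=
  ∀ W ∈ 𝓝 (E.toTotal f x), ∀ᶠ y in 𝓝 x, ∃ b : E.Fiber y, (⟨y, b⟩ : E.Total) ∈ W ∧ ‖f y - b‖ ≤ ε

variable {E}

/-- One `δ` comes from `g - f` at `y`, the other from a vector near `g x - f x` over `y`; `η` is the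
slack needed because upper semicontinuity preserves only strict bounds. -/
theorem AlmostContinuousAt.of_eventually_norm_sub_le {f g : ∀ x, E.Fiber x} {ε δ η : ℝ} {x : Ω}
    (hf : E.AlmostContinuousAt f ε x) (h : ∀ᶠ y in 𝓝 x, ‖g y - f y‖ ≤ δ) (hη : 0 < η) :
    E.AlmostContinuousAt g (ε + 2 * δ + η) x := by
  intro W hW
  have hW' : W ∈ 𝓝 (⟨x, f x + (g x - f x)⟩ : E.Total) := by rwa [add_sub_cancel]
  obtain ⟨A, hA, B, hB, hAB⟩ := E.exists_nhds_add hW'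
  have hC : {p : E.Total | ‖p.snd‖ < δ + η} ∈ 𝓝 (⟨x, g x - f x⟩ : E.Total) :=
    E.upperSemicontinuous_norm _ _ (by
      change ‖g x - f x‖ < _
      linarith [h.self_of_nhds])
  have hproj := E.isOpenMap_proj.image_mem_nhds (Filter.inter_mem hB hC)
  filter_upwards [hf A hA, h, hproj] with y ⟨a, ha, hfa⟩ hy ⟨⟨y', b⟩, ⟨hb, hbC⟩, hyy'⟩
  obtain rfl : y' = y := hyy'
  refine ⟨a + b, hAB _ _ _ ha hb, ?_⟩
  have hb' : ‖b‖ < δ + η := hbC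
  have e : g y' - (a + b) = (g y' - f y') + (f y' - a) - b := by abel
  rw [e]
  linarith [norm_sub_le (g y' - f y' + (f y' - a)) b, norm_add_le (g y' - f y') (f y' - a)]

theorem continuousAt_of_almostContinuousAt {f : ∀ x, E.Fiber x} {x : Ω}
    (h : ∀ ε : ℝ, 0 < ε → E.AlmostContinuousAt f ε x) : ContinuousAt (E.toTotal f) x := by
  intro W hW
  have hW' : W ∈ 𝓝 (⟨x, f x + 0⟩ : E.Total) := by rwa [add_zero]
  obtain ⟨A, hA, B, hB, hAB⟩ := E.exists_nhds_add hW'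
  obtain ⟨B', hB'B, hB', hx⟩ := mem_nhds_iff.1 hB
  obtain ⟨ε, hε, U, hU, hxU, hUB⟩ := E.zero_nhds x B' hB' hx
  rw [Filter.mem_map]
  filter_upwards [h ε hε A hA, hU.mem_nhds hxU] with y ⟨a, ha, hfa⟩ hy
  have := hAB y a (f y - a) ha (hB'B (hUB ⟨y, f y - a⟩ hy hfa))
  rwa [add_sub_cancel] at this

/-- The error is weighted by `∑ c i y` so that it adds up in the induction. Terms whose support
misses `x` vanish near `x`, so nothing is asked of them. -/
theorem exists_near_sum_smul {ι : Type*} (I : Finset ι) {c : ι → C(Ω, ℝ)} (hc : ∀ i x, 0 ≤ c i x)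
    {f : ι → ∀ x, E.Fiber x} {ε : ℝ} {x : Ω}
    (hf : ∀ i, x ∈ tsupport (c i) → E.AlmostContinuousAt (f i) ε x) :
    ∀ W ∈ 𝓝 (⟨x, ∑ i ∈ I, (c i x : 𝕜) • f i x⟩ : E.Total), ∀ᶠ y in 𝓝 x, ∃ b : E.Fiber y,
      (⟨y, b⟩ : E.Total) ∈ W ∧ ‖∑ i ∈ I, (c i y : 𝕜) • f i y - b‖ ≤ (∑ i ∈ I, c i y) * ε := by
  classical
  induction I using Finset.induction_on with
  | empty =>
    intro W hW
    rw [Finset.sum_empty] at hW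
    have h := E.continuous_toTotal_zero.continuousAt (x := x) hW
    filter_upwards [h] with y hy
    exact ⟨0, hy, by simp⟩
  | insert j I hj ih =>
    intro W hW
    rw [Finset.sum_insert hj] at hW
    by_cases hx : x ∈ tsupport (c j)
    · obtain ⟨A, hA, B, hB, hAB⟩ := E.exists_nhds_add hW
      have hcont : Continuous fun q : Ω × E.Total =>
          (⟨q.2.proj, ((c j q.1 : ℝ) : 𝕜) • q.2.snd⟩ : E.Total) :=
        E.continuous_smul.comp (f := fun q : Ω × E.Total => (((c j q.1 : ℝ) : 𝕜), q.2))
          ((RCLike.continuous_ofReal.comp ((c j).continuous.comp continuous_fst)).prodMk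
            continuous_snd)
      obtain ⟨U, hU, A', hA', hUA⟩ := mem_nhds_prod_iff.1
        (hcont.continuousAt (x := (x, (⟨x, f j x⟩ : E.Total))) hA)
      filter_upwards [hf j hx A' hA', ih B hB, hU] with y ⟨a, ha, hfa⟩ ⟨b, hb, hfb⟩ hy
      refine ⟨((c j y : ℝ) : 𝕜) • a + b, hAB y _ _ ?_ hb, ?_⟩
      · exact hUA (Set.mk_mem_prod hy ha)
      · rw [Finset.sum_insert hj, Finset.sum_insert hj, add_sub_add_comm, ← smul_sub, add_mul]
        refine (norm_add_le _ _).trans (add_le_add ?_ hfb)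
        rw [norm_smul, RCLike.norm_ofReal, abs_of_nonneg (hc j y)]
        exact mul_le_mul_of_nonneg_left hfa (hc j y)
    · have h0 := notMem_tsupport_iff_eventuallyEq.1 hx
      have hx0 : c j x = 0 := h0.self_of_nhds
      rw [hx0, RCLike.ofReal_zero, zero_smul, zero_add] at hW
      filter_upwards [ih W hW, h0] with y ⟨b, hb, hfb⟩ hy
      refine ⟨b, hb, ?_⟩
      have hy0 : c j y = 0 := hy
      rwa [Finset.sum_insert hj, Finset.sum_insert hj, hy0, RCLike.ofReal_zero, zero_smul, zero_add,
        zero_add]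

theorem almostContinuousAt_sum_smul {ι : Type*} (I : Finset ι) {c : ι → C(Ω, ℝ)}
    (hc : ∀ i x, 0 ≤ c i x) (hc1 : ∀ x, ∑ i ∈ I, c i x ≤ 1) {f : ι → ∀ x, E.Fiber x} {ε : ℝ}
    (hε : 0 ≤ ε) {x : Ω} (hf : ∀ i, x ∈ tsupport (c i) → E.AlmostContinuousAt (f i) ε x) :
    E.AlmostContinuousAt (fun y => ∑ i ∈ I, (c i y : 𝕜) • f i y) ε x := by
  intro W hW
  filter_upwards [exists_near_sum_smul I hc hf W hW] with y ⟨b, hb, hfb⟩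
  exact ⟨b, hb, hfb.trans (mul_le_of_le_one_left hε (hc1 y))⟩

variable (E) in
-- Any selection from a thin open neighborhood of `a` works: the projection is open, so vectors of
-- that neighborhood exist over all nearby points and differ from the selection by less than `ε`.
theorem exists_almostContinuousAt {x : Ω} (a : E.Fiber x) {W : Set E.Total}
    (hW : W ∈ 𝓝 (⟨x, a⟩ : E.Total)) {ε : ℝ} (hε : 0 < ε) :
    ∃ g : ∀ y, E.Fiber y, g x = a ∧
      ∀ᶠ y in 𝓝 x, E.AlmostContinuousAt g ε y ∧ (⟨y, g y⟩ : E.Total) ∈ W := by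
  classical
  obtain ⟨V, hV, hthin⟩ := E.exists_thin_nhds a hε
  obtain ⟨V', hV', hV'o, haV'⟩ := mem_nhds_iff.1 (Filter.inter_mem hV hW)
  have h0 : ∀ y, ∃ b : E.Fiber y, y ∈ (fun p : E.Total => p.proj) '' V' →
      (⟨y, b⟩ : E.Total) ∈ V' := fun y => by
    by_cases hy : y ∈ (fun p : E.Total => p.proj) '' V'
    · obtain ⟨⟨y, b⟩, hb, rfl⟩ := hy
      exact ⟨b, fun _ => hb⟩
    · exact ⟨0, fun h => (hy h).elim⟩
  choose g₀ hg₀ using h0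
  let g : ∀ y, E.Fiber y := Function.update g₀ x a
  have hga : g x = a := Function.update_self x a g₀
  have hg : ∀ y ∈ (fun p : E.Total => p.proj) '' V', (⟨y, g y⟩ : E.Total) ∈ V' := fun y hy => by
    by_cases hyx : y = x
    · subst hyx
      rwa [hga]
    · have : g y = g₀ y := Function.update_of_ne hyx a g₀
      rw [this]
      exact hg₀ y hy
  have hU := E.isOpenMap_proj V' hV'o
  refine ⟨g, hga, ?_⟩
  filter_upwards [hU.mem_nhds ⟨⟨x, a⟩, haV', rfl⟩] with y hy
  refine ⟨fun S hS => ?_, (hV' (hg y hy)).2⟩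
  have h1 := E.isOpenMap_proj.image_mem_nhds (Filter.inter_mem hS (hV'o.mem_nhds (hg y hy)))
  filter_upwards [h1, hU.mem_nhds hy] with z ⟨⟨z', b⟩, ⟨hbS, hbV⟩, hz⟩ hzU
  obtain rfl : z' = z := hz
  exact ⟨b, hbS, (hthin _ _ _ (hV' (hg z' hzU)).1 (hV' hbV).1).le⟩

variable [T2Space Ω] [LocallyCompactSpace Ω]

/-- Near each point, a `δ`-continuous selection and a vector `ε`-close to `f` lie in one `δ`-thin
set, hence the distance `ε + δ`. A partition of unity glues the selections without enlarging either
error. -/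
theorem exists_almostContinuousAt_refinement {K : Set Ω} (hK : IsCompact K)
    {f : ∀ x, E.Fiber x} {ε δ : ℝ} (hf : ∀ x ∈ K, E.AlmostContinuousAt f ε x) (hδ : 0 < δ)
    (x₀ : Ω) (hx₀ : x₀ ∈ K) :
    ∃ g : ∀ x, E.Fiber x, (∀ x ∈ K, E.AlmostContinuousAt g δ x) ∧
      (∀ x ∈ K, ‖g x - f x‖ ≤ ε + δ) ∧ g x₀ = f x₀ := by
  classical
  have h0 : ∀ x : K, ∃ g : ∀ y, E.Fiber y, g x = f x ∧
      ∀ᶠ y in 𝓝 (x : Ω), E.AlmostContinuousAt g δ y ∧ ‖g y - f y‖ ≤ ε + δ := by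
    rintro ⟨x, hx⟩
    obtain ⟨W, hW, hthin⟩ := E.exists_thin_nhds (f x) hδ
    obtain ⟨g, hgx, hg⟩ := E.exists_almostContinuousAt (f x) hW hδ
    refine ⟨g, hgx, ?_⟩
    filter_upwards [hg, hf x hx W hW] with y ⟨h1, h2⟩ ⟨b, hb, hfb⟩
    refine ⟨h1, ?_⟩
    have h3 := hthin y _ _ h2 hb
    rw [norm_sub_rev] at hfb
    have e : g y - f y = (g y - b) + (b - f y) := by abel
    rw [e]
    linarith [norm_add_le (g y - b) (b - f y)]
  choose g hgx hg using h0
  let V : K → Set Ω := fun i =>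
    interior {y | E.AlmostContinuousAt (g i) δ y ∧ ‖g i y - f y‖ ≤ ε + δ}
  have hiV : ∀ i : K, (i : Ω) ∈ V i := fun i => mem_interior_iff_mem_nhds.2 (hg i)
  -- Only the selection based at `x₀` may contribute at `x₀`, which keeps the value there exact.
  let U : K → Set Ω := fun i => if (i : Ω) = x₀ then V i else V i \ {x₀}
  have hUV : ∀ i, U i ⊆ V i := fun i => by
    by_cases hi : (i : Ω) = x₀
    · simp [U, hi]
    · simp only [U, hi, if_false]
      exact Set.sdiff_subset
  have hU : ∀ i, IsOpen (U i) := fun i => by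
    have hV : IsOpen (V i) := isOpen_interior
    by_cases hi : (i : Ω) = x₀
    · simpa only [U, hi, if_true] using hV
    · simpa only [U, hi, if_false] using hV.sdiff isClosed_singleton
  have hKU : K ⊆ ⋃ i, U i := fun x hx => Set.mem_iUnion.2 ⟨⟨x, hx⟩, by
    by_cases hi : x = x₀
    · simpa [U, hi] using hiV ⟨x₀, hx₀⟩
    · simpa [U, hi] using hiV ⟨x, hx⟩⟩
  obtain ⟨I, φ, h1, -, h3, h4, h5⟩ := exists_finset_partition hK U hU hKU
  refine ⟨fun y => ∑ i ∈ I, (φ i y : 𝕜) • g i y, fun x hx => ?_, fun x hx => ?_, ?_⟩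
  · exact almostContinuousAt_sum_smul I h3 h4 hδ.le fun i hi =>
      (interior_subset (hUV i (h1 i hi))).1
  · refine norm_sum_smul_sub_le I (fun i => φ i x) (fun i => h3 i x) (h4 x) _ _ (fun i _ hi => ?_)
      (Or.inl (h5 x hx))
    exact (interior_subset (hUV i (h1 i (subset_tsupport _ hi)))).2
  · have h6 : ∀ i ∈ I, (φ i x₀ : 𝕜) • g i x₀ = (φ i x₀ : 𝕜) • f x₀ := fun i _ => by
      by_cases hi : (i : Ω) = x₀
      · obtain ⟨x, hx⟩ := i
        obtain rfl : x = x₀ := hi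
        rw [hgx]
      · have : φ i x₀ = 0 := image_eq_zero_of_notMem_tsupport fun h => by
          simpa [U, hi] using h1 i h
        simp [this]
    change ∑ i ∈ I, (φ i x₀ : 𝕜) • g i x₀ = f x₀
    rw [Finset.sum_congr rfl h6, ← Finset.sum_smul, ← RCLike.ofReal_sum, h5 x₀ hx₀,
      RCLike.ofReal_one, one_smul]

variable (E) in
-- Iterated refinement halves the continuity error while fixing the value at `x`. The steps are
-- summable, so the limit is uniform on `K` and continuous at interior points of `K`.
theorem exists_local_section {x : Ω} (a : E.Fiber x) :
    ∃ g : ∀ y, E.Fiber y, g x = a ∧ ∀ᶠ y in 𝓝 x, ContinuousAt (E.toTotal g) y := by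
  classical
  obtain ⟨f₀, hf₀a, hf₀⟩ := E.exists_almostContinuousAt a Filter.univ_mem one_pos
  obtain ⟨K, hKx, hKf, hK⟩ := local_compact_nhds hf₀
  have hxK : x ∈ K := mem_of_mem_nhds hKx
  let P : ℕ → (∀ y, E.Fiber y) → Prop := fun n f =>
    (∀ y ∈ K, E.AlmostContinuousAt f (1 / 2 ^ n) y) ∧ f x = a
  -- The refinement gives `1 / 2 ^ n + 1 / 2 ^ (n + 1)`; the weaker bound has the shape `C / 2 / 2 ^
  -- n` of the geometric Cauchy criterion.
  have step : ∀ n f, P n f → ∃ g, P (n + 1) g ∧ ∀ y ∈ K, ‖g y - f y‖ ≤ 4 / 2 / 2 ^ n := by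
    intro n f hf
    obtain ⟨g, h1, h2, h3⟩ := exists_almostContinuousAt_refinement hK hf.1
      (δ := 1 / 2 ^ (n + 1)) (by positivity) x hxK
    refine ⟨g, ⟨h1, h3.trans hf.2⟩, fun y hy => (h2 y hy).trans ?_⟩
    rw [pow_succ]
    have : (0 : ℝ) < 1 / 2 ^ n := by positivity
    have e1 : (1 : ℝ) / (2 ^ n * 2) = 1 / 2 ^ n / 2 := by field_simp
    have e2 : (4 : ℝ) / 2 / 2 ^ n = 2 * (1 / 2 ^ n) := by field_simp; norm_num
    rw [e1, e2]
    linarith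
  choose next hnext hdist using step
  let F : ∀ n, {f // P n f} := fun n => Nat.rec
    ⟨f₀, fun y hy => by simpa using (hKf hy).1, hf₀a⟩
    (fun n f => ⟨next n f.1 f.2, hnext n f.1 f.2⟩) n
  have hF : ∀ n, ∀ y ∈ K, dist ((F n).1 y) ((F (n + 1)).1 y) ≤ 4 / 2 / 2 ^ n := fun n y hy => by
    rw [dist_comm, dist_eq_norm]
    exact hdist n (F n).1 (F n).2 y hy
  have hlim : ∀ y, ∃ b : E.Fiber y, y ∈ K →
      Filter.Tendsto (fun n => (F n).1 y) Filter.atTop (𝓝 b) := fun y => by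
    by_cases hy : y ∈ K
    · obtain ⟨b, hb⟩ := cauchySeq_tendsto_of_complete
        (cauchySeq_of_le_geometric_two fun n => hF n y hy)
      exact ⟨b, fun _ => hb⟩
    · exact ⟨0, fun h => (hy h).elim⟩
  choose g hg using hlim
  have hgF : ∀ n, ∀ y ∈ K, ‖g y - (F n).1 y‖ ≤ 4 / 2 ^ n := fun n y hy => by
    rw [← dist_eq_norm, dist_comm]
    exact dist_le_of_le_geometric_two_of_tendsto (fun n => hF n y hy) (hg y hy) n
  refine ⟨g, tendsto_nhds_unique (hg x hxK) ?_, ?_⟩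
  · simp only [(F _).2.2]
    exact tendsto_const_nhds
  · filter_upwards [eventually_mem_nhds_iff.2 hKx] with y hy
    refine continuousAt_of_almostContinuousAt fun ε hε => ?_
    -- The total error is `1 / 2 ^ n + 2 * (4 / 2 ^ n) + ε / 10`, that is, nine terms below `ε / 10`
    -- and one equal to it.
    obtain ⟨n, hn⟩ := exists_pow_lt_of_lt_one (show 0 < ε / 10 by positivity)
      (show (1 / 2 : ℝ) < 1 by norm_num)
    have h1 := ((F n).2.1 y (mem_of_mem_nhds hy)).of_eventually_norm_sub_le
      (Filter.mem_of_superset hy (hgF n)) (show 0 < ε / 10 by positivity)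
    intro W hW
    filter_upwards [h1 W hW] with z ⟨b, hb, hgb⟩
    refine ⟨b, hb, hgb.trans ?_⟩
    rw [div_pow, one_pow] at hn
    have e : (4 : ℝ) / 2 ^ n = 4 * (1 / 2 ^ n) := by ring
    rw [e]
    linarith

variable (E) in
/-- There are enough continuous sections vanishing at infinity. -/
theorem exists_sectionsZero_apply_eq {x : Ω} (a : E.Fiber x) : ∃ s : E.SectionsZero, s x = a := by
  obtain ⟨g, hga, hg⟩ := E.exists_local_section a
  obtain ⟨φ, hφ, hφc, hφg⟩ := exists_isBump hg
  refine ⟨⟨fun y => (φ y : 𝕜) • g y, continuous_iff_continuousAt.2 fun y => ?_, fun ε hε =>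
    ⟨tsupport φ, hφc, fun y hy => ?_⟩⟩, ?_⟩
  · by_cases hy : y ∈ tsupport φ
    · exact E.continuousAt_smul (RCLike.continuous_ofReal.comp (map_continuous φ)).continuousAt
        (hφg hy)
    · refine (E.continuous_toTotal_zero.continuousAt (x := y)).congr ?_
      filter_upwards [notMem_tsupport_iff_eventuallyEq.1 hy] with z hz
      simp only [toTotal, hz, Pi.zero_apply, RCLike.ofReal_zero, zero_smul]
  · simp only [image_eq_zero_of_notMem_tsupport hy, RCLike.ofReal_zero, zero_smul, norm_zero]
    exact hε.le
  · change (φ x : 𝕜) • g x = a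
    rw [hφ.eventually_eq_one.self_of_nhds, RCLike.ofReal_one, one_smul, hga]

end BanachBundle

/-! ### Uniqueness of the bundle -/

namespace BanachBundle

variable {𝕜 : Type*} [RCLike 𝕜] {Ω : Type u} [TopologicalSpace Ω] [T2Space Ω]
  [LocallyCompactSpace Ω] {E : BanachBundle.{u, w₁} 𝕜 Ω} {F : BanachBundle.{u, w₂} 𝕜 Ω}

theorem SectionsZero.exists_isBump_norm_smul_le (s : E.SectionsZero) {x : Ω} {M : ℝ}
    (h : ‖s x‖ < M) : ∃ φ : C₀(Ω, ℝ), IsBump x φ ∧ ‖ofRealC₀ 𝕜 φ • s‖ ≤ M := by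
  obtain ⟨φ, hφ, -, hφU⟩ := exists_isBump (s.eventually_norm_lt h)
  have hM : 0 < M := (norm_nonneg _).trans_lt h
  refine ⟨φ, hφ, SectionsZero.norm_le_of_forall hM.le fun y => ?_⟩
  rw [SectionsZero.smul_apply, ofRealC₀_apply, norm_smul, RCLike.norm_ofReal,
    abs_of_nonneg (hφ.mem_Icc y).1]
  by_cases hy : y ∈ tsupport φ
  · have h1 : ‖s y‖ < M := hφU hy
    exact (mul_le_of_le_one_left (norm_nonneg _) (hφ.mem_Icc y).2).trans h1.le
  · rw [image_eq_zero_of_notMem_tsupport hy, zero_mul]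
    exact hM.le

/-- A bump shrinks the global norm of `s` to nearly `‖s x‖` without changing the value at `x`; `T`
preserves the norm and commutes with the bump. -/
theorem norm_map_apply_le (T : E.SectionsZero ≃ₗᵢ[𝕜] F.SectionsZero)
    (hT : ∀ (f : C₀(Ω, 𝕜)) (s : E.SectionsZero), T (f • s) = f • T s) (s : E.SectionsZero) (x : Ω) :
    ‖T s x‖ ≤ ‖s x‖ := by
  refine le_of_forall_gt_imp_ge_of_dense fun M hM => ?_
  obtain ⟨φ, hφ, h⟩ := s.exists_isBump_norm_smul_le hM
  have h1 := SectionsZero.norm_apply_le (T (ofRealC₀ 𝕜 φ • s)) x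
  rw [T.norm_map, hT, SectionsZero.smul_apply, ofRealC₀_apply,
    hφ.eventually_eq_one.self_of_nhds, RCLike.ofReal_one, one_smul] at h1
  exact h1.trans h

theorem norm_map_apply (T : E.SectionsZero ≃ₗᵢ[𝕜] F.SectionsZero)
    (hT : ∀ (f : C₀(Ω, 𝕜)) (s : E.SectionsZero), T (f • s) = f • T s) (s : E.SectionsZero) (x : Ω) :
    ‖T s x‖ = ‖s x‖ := by
  refine le_antisymm (norm_map_apply_le T hT s x) ?_
  have h := norm_map_apply_le T.symm (fun f t => by
    rw [LinearIsometryEquiv.symm_apply_eq, hT, T.apply_symm_apply]) (T s) x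
  rwa [T.symm_apply_apply] at h

/-- A module isomorphism of the spaces of sections is induced by isomorphisms of the fibers. -/
theorem exists_fiberEquiv (T : E.SectionsZero ≃ₗᵢ[𝕜] F.SectionsZero)
    (hT : ∀ (f : C₀(Ω, 𝕜)) (s : E.SectionsZero), T (f • s) = f • T s) (x : Ω) :
    ∃ L : E.Fiber x ≃ₗᵢ[𝕜] F.Fiber x, ∀ s : E.SectionsZero, T s x = L (s x) := by
  choose σ hσ using fun a : E.Fiber x => E.exists_sectionsZero_apply_eq a
  -- Makes the fiber map independent of the chosen sections `σ`, which need not depend linearly on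
  -- the vector.
  have key : ∀ (s t : E.SectionsZero), s x = t x → T s x = T t x := fun s t h => by
    rw [← sub_eq_zero, ← SectionsZero.sub_apply, ← norm_eq_zero, ← map_sub, norm_map_apply T hT,
      SectionsZero.sub_apply, h, sub_self, norm_zero]
  let L : E.Fiber x →ₗᵢ[𝕜] F.Fiber x :=
    { toFun := fun a => T (σ a) x
      map_add' := fun a b => by
        have h := key (σ (a + b)) (σ a + σ b) (by
          rw [hσ]
          change a + b = σ a x + σ b x
          rw [hσ, hσ])
        rw [h, map_add]
        rfl
      map_smul' := fun c a => by
        have h := key (σ (c • a)) (c • σ a) (by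
          rw [hσ]
          change c • a = c • σ a x
          rw [hσ])
        rw [h, map_smul]
        rfl
      norm_map' := fun a => by
        change ‖T (σ a) x‖ = ‖a‖
        rw [norm_map_apply T hT, hσ] }
  have hL : ∀ s : E.SectionsZero, T s x = L (s x) := fun s => key _ _ (hσ (s x)).symm
  have hsurj : Function.Surjective L := fun b => by
    obtain ⟨t, rfl⟩ := F.exists_sectionsZero_apply_eq b
    exact ⟨T.symm t x, by rw [← hL, T.apply_symm_apply]⟩
  exact ⟨LinearIsometryEquiv.ofSurjective L hsurj, hL⟩

/-- A fiberwise isometric map is continuous if it preserves continuity of sections. -/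
theorem continuous_of_forall_section (L : ∀ x, E.Fiber x ≃ₗᵢ[𝕜] F.Fiber x)
    (h : ∀ s : E.SectionsZero, Continuous (F.toTotal fun x => L x (s x))) :
    Continuous fun p : E.Total => (⟨p.proj, L p.proj p.snd⟩ : F.Total) := by
  refine continuous_iff_continuousAt.2 ?_
  rintro ⟨x, a⟩ W hW
  obtain ⟨s, rfl⟩ := E.exists_sectionsZero_apply_eq a
  have hW' : W ∈ 𝓝 (⟨x, L x (s x) + 0⟩ : F.Total) := by rwa [add_zero]
  obtain ⟨A, hA, B, hB, hAB⟩ := F.exists_nhds_add hW'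
  obtain ⟨B', hB'B, hB', hx⟩ := mem_nhds_iff.1 hB
  obtain ⟨ε, hε, U, hU, hxU, hUB⟩ := F.zero_nhds x B' hB' hx
  -- Vectors near `s x` differ little from `s` in their own fiber. The isometry `L` keeps this
  -- difference small, and the image of `s` is continuous.
  have h0 : {p : E.Total | ‖p.snd‖ < ε} ∈ 𝓝 (⟨x, s x + (-s) x⟩ : E.Total) :=
    E.upperSemicontinuous_norm _ ε (by
      change ‖s x + -(s x)‖ < ε
      simpa using hε)
  obtain ⟨C, hC, D, hD, hCD⟩ := E.exists_nhds_add h0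
  have hproj : Filter.Tendsto (fun p : E.Total => p.proj) (𝓝 ⟨x, s x⟩) (𝓝 x) :=
    E.continuous_proj.tendsto _
  have h1 := hproj.eventually ((h s).continuousAt (x := x) hA)
  have h2 := hproj.eventually ((-s).2.1.continuousAt (x := x) hD)
  rw [Filter.mem_map]
  filter_upwards [hC, h1, h2, hproj.eventually (hU.mem_nhds hxU)] with ⟨y, b⟩ h3 h4 h5 h6
  have h7 : ‖b + -(s y)‖ < ε := hCD y b ((-s) y) h3 h5
  have h8 := hAB y (L y (s y)) (L y (b + -(s y))) h4 (hB'B (hUB ⟨y, _⟩ h6 (by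
    change ‖L y (b + -(s y))‖ ≤ ε
    rw [LinearIsometryEquiv.norm_map]
    exact h7.le)))
  rw [← map_add, add_comm, neg_add_cancel_right] at h8
  exact h8

theorem nonempty_isometricIso (T : E.SectionsZero ≃ₗᵢ[𝕜] F.SectionsZero)
    (hT : ∀ (f : C₀(Ω, 𝕜)) (s : E.SectionsZero), T (f • s) = f • T s) :
    Nonempty (IsometricIso E F) := by
  choose L hL using exists_fiberEquiv T hT
  refine ⟨⟨L, continuous_of_forall_section L fun s => ?_,
    continuous_of_forall_section (fun x => (L x).symm) fun t => ?_⟩⟩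
  · simp only [← hL]
    exact (T s).2.1
  · have : ∀ x, (L x).symm (t x) = T.symm t x := fun x => by
      rw [LinearIsometryEquiv.symm_apply_eq, ← hL, T.apply_symm_apply]
    simp only [this]
    exact (T.symm t).2.1

end BanachBundle

end RepBundle

end

theorem mainTheorem6 {𝕜 : Type*} [RCLike 𝕜]
    {Ω : Type u} [TopologicalSpace Ω] [T2Space Ω] [LocallyCompactSpace Ω]
    {Γ : Type v} [NormedAddCommGroup Γ] [NormedSpace 𝕜 Γ] [CompleteSpace Γ] [SMul C₀(Ω, 𝕜) Γ]
    [RepBundle.IsBanachModule 𝕜 C₀(Ω, 𝕜) Γ] (hΓ : RepBundle.IsAMModule 𝕜 Ω Γ) :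
    (∃ E : RepBundle.BanachBundle.{u, v} 𝕜 Ω,
      RepBundle.IsometricallyIsomorphicModules 𝕜 C₀(Ω, 𝕜) Γ E.SectionsZero) ∧
    (∀ (E : RepBundle.BanachBundle.{u, w₁} 𝕜 Ω) (F : RepBundle.BanachBundle.{u, w₂} 𝕜 Ω),
      RepBundle.IsometricallyIsomorphicModules 𝕜 C₀(Ω, 𝕜) Γ E.SectionsZero →
      RepBundle.IsometricallyIsomorphicModules 𝕜 C₀(Ω, 𝕜) Γ F.SectionsZero →
      Nonempty (RepBundle.BanachBundle.IsometricIso E F)) := by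
  refine ⟨⟨_, hΓ.isometricallyIsomorphic_sections⟩, ?_⟩
  rintro E F ⟨S, hS⟩ ⟨T, hT⟩
  exact RepBundle.BanachBundle.nonempty_isometricIso (S.symm.trans T) fun f s => by
    have h : S.symm (f • s) = f • S.symm s := by
      rw [LinearIsometryEquiv.symm_apply_eq, hS, S.apply_symm_apply]
    rw [LinearIsometryEquiv.trans_apply, h, hT, LinearIsometryEquiv.trans_apply]
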